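/- **Setting.** Let $T>0$, let $M\ge 2$ and $n_0\ge 1$ be integers, and put $\mathbf h=T/n_0$. On a filtered probability space let $W$ be a $q$-dimensional Brownian motion and let $X$ be the strong solution on $[0,T]$ of $$dX_t=b(X_t)\,dt+\sum_{j=1}^q\sigma_j(X_t)\,dW^j_t,\qquad X_0=x\in\mathbb R^d,$$ where $b,\sigma_1,\dots,\sigma_q$ are globally Lipschitz. Let $X^h$ be a one-step discretization scheme with step $h$ (for instance the Euler or the Milstein scheme), $X^h_{(i+1)h}=\Phi(h,X^h_{ih},W_{(i+1)h}-W_{ih})$ with $\Phi(h,\cdot,\cdot)$ Borel measurable. For $\theta\in\mathbb R^q$ let $X^h_{\cdot,\theta}$ be the same scheme with each increment $\Delta W$ replaced by $\Delta W+\theta h$, i.e. the scheme for the equation with drift $b+\sigma\theta$. Put $\mathcal J^-(W_T,\theta)=\exp(-\langle\theta,W_T\rangle-\tfrac12|\theta|^2T)$. Let $P:\mathbb R^d\to\mathbb R$ be Borel with $P(X_T)\in L^p$ and $\mathrm{Var}(P(X_T))>0$, where $p\ge2$. Let $\mathcal H=\{\mathbf h/n:n\ge1\}$ and assume: * *Weak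 error*: there are $\alpha>0$ and $(c_k)_{k\ge1}$ with $\mathbb E P(X^h_T)-\mathbb E P(X_T)=\sum_{k=1}^{\bar L}c_kh^{\alpha k}+o(h^{\alpha\bar L})$ as $h\to0$ in $\mathcal H$, for every $\bar L\ge1$, and $\tilde c_\infty=\lim_{L}|c_L|^{1/L}\in(0,\infty)$ exists. * *Strong error*: there are $\beta>0$ and $V_1>0$ with $\mathbb E|P(X^h_T)-P(X_T)|^2\le V_1h^\beta$ for $h\in\mathcal H$. * *$L^r$-strong error*: for some $r>p$ (for example $r=p^2$) and $V^{(r)}>0$, $\mathbb E|P(X^h_T)-P(X_T)|^r\le V^{(r)}h^{\beta r/2}$ for $h\in\mathcal H$. **Parameters.** For $L\ge1$ let $w=(w_1,\dots,w_L)$ solve $\sum_{j=1}^L M^{-\alpha(i-1)(j-1)}w_j=\mathbf 1_{\{i=1\}}$, $1\le i\le L$, and put $\widetilde W_l=\sum_{j=l}^Lw_j$. Let $\lambda=\sqrt{V_1/\mathrm{Var}(P(X_T))}$, $\underline C=\frac{1+M^{\beta/2}}{\sqrt{1+M^{-1}}}$, $\overline C=(1+M^{\beta/2})\sqrt{1+M^{-1}}$.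 For $\varepsilon>0$ set, with $a=\frac12+\frac{\log(\tilde c_\infty^{1/\alpha}\mathbf h)}{\log M}$, $$L=L(\varepsilon)=\Big\lceil a+\sqrt{a^2+\tfrac{2\log(\sqrt{1+4\alpha}/\varepsilon)}{\alpha\log M}}\Big\rceil,$$ $$\mu_1=q^*(1+\lambda\mathbf h^{\beta/2}),\qquad \mu_l=q^*\lambda\mathbf h^{\beta/2}\,\underline C\,|\widetilde W_l|\,M^{-\frac{1+\beta}2(l-1)}\ (2\le l\le L),\qquad \sum_{l=1}^L\mu_l=1,$$ $$N=\Big(1+\frac1{2\alpha L}\Big)\frac{\mathrm{Var}(P(X_T))\big(1+\lambda\mathbf h^{\beta/2}+\lambda\mathbf h^{\beta/2}\,\overline C\sum_{l=2}^L|\widetilde W_l|M^{\frac{1-\beta}2(l-1)}\big)}{\varepsilon^2q^*},\qquad N_l=\lceil N\mu_l\rceil .$$ (If $\varepsilon$ is so large that the square root is not real, it is read as $0$; for $L\le1$ the sum over levels below is empty.) **Estimator.** Let $(W^{l,k})_{l,k}$ be independent $q$-dimensional Brownian motions, $\mathcal F_{T,k}$ the $\sigma$-algebra generated by $W^{l,j}_t$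 for all $l$, $1\le j\le k$, $t\le T$, and let $\theta_l^k$ ($l\ge2$, $k\ge0$) be $\mathcal F_{T,k}$-measurable random vectors with values in a compact set $\Theta\subset\{|\theta|\le c\}\subset\mathbb R^q$, $c>0$. Write $n_l=n_0M^{l-1}$, let $X^{n_l,k}_{T,\theta}$ be the terminal value of the scheme with $n_l$ steps of size $T/n_l$ driven by $W^{l,k}$, and $X^{n_{l-1},k}_{T,\theta}$ that of the scheme with $n_{l-1}$ steps driven by the same path. Let $$\widetilde Y^k_{l,\theta}=\big(P(X^{n_l,k}_{T,\theta})-P(X^{n_{l-1},k}_{T,\theta})\big)\mathcal J^-(W^{l,k}_T,\theta)-\mathbb E\big[P(X^{n_l}_T)-P(X^{n_{l-1}}_T)\big],\qquad \widetilde{\mathbf J}^{2,\varepsilon}_{\theta,\pi}=\sum_{l=2}^{L}\frac{\widetilde W_l}{N_l}\sum_{k=1}^{N_l}\widetilde Y^k_{l,\theta_l^{k-1}}$$ (a level with $\widetilde W_l=0$ contributes $0$). **Proposition.** There is a constant $K_2>0$, depending only on $M,\beta,p,c$ and on $T,\mathbf h,V_1,r,V^{(r)}$ (in particular not on $\varepsilon$,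 on $L$, nor on the sequences $\theta_l^k$), such that for every $\varepsilon>0$ $$\mathbb E\big[|\widetilde{\mathbf J}^{2,\varepsilon}_{\theta,\pi}|^p\big]\le K_2\,\varepsilon^p .$$ -/

import Mathlib

open MeasureTheory ProbabilityTheory Filter Topology Set
open scoped NNReal ENNReal Matrix

noncomputable section

/-- Euclidean space `ℝⁿ`. -/
abbrev Vec (n : ℕ) : Type := EuclideanSpace ℝ (Fin n)

/-! ### Brownian motion and stochastic differential equations -/

/-- A standard `q`-dimensional Brownian motion: the coordinates are independent real Brownian
motions. -/
structure IsBrownianMotion {Ω : Type*} [MeasurableSpace Ω] {q : ℕ}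
    (W : ℝ≥0 → Ω → Vec q) (μ : Measure Ω) : Prop where
  measurable : ∀ t, Measurable (W t)
  coord : ∀ j : Fin q, IsBrownianReal (fun t ω => W t ω j) μ
  indep : iIndepFun (fun (j : Fin q) (ω : Ω) (t : ℝ≥0) => W t ω j) μ

/-- A standard `q`-dimensional Brownian motion relative to the filtration `ℱ`. -/
structure IsFilteredBrownianMotion {Ω : Type*} [mΩ : MeasurableSpace Ω] {q : ℕ}
    (ℱ : Filtration ℝ≥0 mΩ) (W : ℝ≥0 → Ω → Vec q) (μ : Measure Ω) : Prop where
  isBrownianMotion : IsBrownianMotion W μ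
  adapted : ∀ t, Measurable[ℱ t] (W t)
  indep_past : ∀ s t : ℝ≥0, s ≤ t →
    Indep (MeasurableSpace.comap (fun ω => W t ω - W s ω) inferInstance) (ℱ s) μ

/-- The left-point Riemann sum `∑ᵢ ∑ⱼ σⱼ(X_{tᵢ}) (Wʲ_{tᵢ₊₁} - Wʲ_{tᵢ})` over the uniform partition
`tᵢ = i t / n` of `[0, t]`. -/
def itoSum {Ω : Type*} {d q : ℕ} (σ : Fin q → Vec d → Vec d) (X : ℝ≥0 → Ω → Vec d)
    (W : ℝ≥0 → Ω → Vec q) (t : ℝ≥0) (n : ℕ) (ω : Ω) : Vec d :=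
  ∑ i ∈ Finset.range n, ∑ j : Fin q,
    (W (((i : ℝ≥0) + 1) * t / n) ω j - W ((i : ℝ≥0) * t / n) ω j) •
      σ j (X ((i : ℝ≥0) * t / n) ω)

/-- `X` is a strong solution on `[0, T]` of `dX = b(X) dt + ∑ⱼ σⱼ(X) dWʲ`, `X₀ = x`.
The integrands `σⱼ(X)` are continuous and adapted, so the Itô integral over `[0, t]` is the limit
in probability of the left-point Riemann sums; `eq` says that this limit is
`X_t - x - ∫₀ᵗ b(X_s) ds`. -/
structure IsStrongSolution {Ω : Type*} [mΩ : MeasurableSpace Ω] {d q : ℕ}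
    (ℱ : Filtration ℝ≥0 mΩ) (μ : Measure Ω) (b : Vec d → Vec d) (σ : Fin q → Vec d → Vec d)
    (x : Vec d) (T : ℝ≥0) (W : ℝ≥0 → Ω → Vec q) (X : ℝ≥0 → Ω → Vec d) : Prop where
  adapted : ∀ t ≤ T, Measurable[ℱ t] (X t)
  continuous : ∀ᵐ ω ∂μ, ContinuousOn (fun t => X t ω) (Iic T)
  init : ∀ᵐ ω ∂μ, X 0 ω = x
  eq : ∀ t ≤ T, TendstoInMeasure μ (fun n : ℕ => itoSum σ X W t n) atTop
    (fun ω => X t ω - x - ∫ s in (0 : ℝ)..t, b (X s.toNNReal ω))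

/-! ### Discretization schemes -/

/-- The scheme `X_{i+1} = Φ(h, X_i, ΔW_i + θ h)`, `X_0 = x`, with `n` steps of size `h = T / n`,
driven by the path `w` with drift `θ`. For `θ = 0` it discretizes the original equation; in general
it discretizes `dX(θ) = (b(X(θ)) + σ(X(θ)) θ) dt + σ(X(θ)) dW`. -/
def schemePath {d q : ℕ} (Φ : ℝ → Vec d → Vec q → Vec d) (x : Vec d) (T : ℝ≥0) (n : ℕ)
    (θ : Vec q) (w : ℝ≥0 → Vec q) : ℕ → Vec d
  | 0 => x
  | i + 1 => Φ ((T : ℝ) / n) (schemePath Φ x T n θ w i)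
      (w (((i : ℝ≥0) + 1) * T / n) - w ((i : ℝ≥0) * T / n) + ((T : ℝ) / n) • θ)

/-- The value at time `T` of the scheme with `n` steps. -/
def schemeEnd {d q : ℕ} (Φ : ℝ → Vec d → Vec q → Vec d) (x : Vec d) (T : ℝ≥0) (n : ℕ)
    (θ : Vec q) (w : ℝ≥0 → Vec q) : Vec d :=
  schemePath Φ x T n θ w n

/-- One step of the Euler-Maruyama scheme. -/
def eulerStep {d q : ℕ} (b : Vec d → Vec d) (σ : Fin q → Vec d → Vec d)
    (h : ℝ) (y : Vec d) (v : Vec q) : Vec d :=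
  y + h • b y + ∑ j, v j • σ j y

/-- One step of the Milstein scheme (without Lévy areas). -/
def milsteinStep {d q : ℕ} (b : Vec d → Vec d) (σ : Fin q → Vec d → Vec d)
    (h : ℝ) (y : Vec d) (v : Vec q) : Vec d :=
  eulerStep b σ h y v +
    (1 / 2 : ℝ) • ∑ i, ∑ j, (v i * v j - if i = j then h else 0) • fderiv ℝ (σ j) y (σ i y)

theorem measurable_eulerStep {d q : ℕ} {b : Vec d → Vec d} {σ : Fin q → Vec d → Vec d}
    (hb : Measurable b) (hσ : ∀ j, Measurable (σ j)) (h : ℝ) :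
    Measurable fun z : Vec d × Vec q => eulerStep b σ h z.1 z.2 := by
  unfold eulerStep
  fun_prop

/-- The likelihood ratio `𝒥⁻(w_T, θ) = exp(-⟨θ, w_T⟩ - ‖θ‖² T / 2)`. -/
def girsanovMinus {q : ℕ} (T : ℝ≥0) (wT θ : Vec q) : ℝ :=
  Real.exp (-inner ℝ θ wT - ‖θ‖ ^ 2 * T / 2)

/-! ### Error assumptions

The coarsest step size is `T / n₀`, and the step sizes considered are `(T / n₀) / n`, `n ≥ 1`. -/

/-- `𝔼 |P(X^h_T) - P(X_T)|^s ≤ V h^{β s / 2}` for all `h = (T / n₀) / n`, `n ≥ 1`. -/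
def StrongError {Ω : Type*} [MeasurableSpace Ω] {d q : ℕ} (μ : Measure Ω)
    (Φ : ℝ → Vec d → Vec q → Vec d) (x : Vec d) (T : ℝ≥0) (n₀ : ℕ) (P : Vec d → ℝ)
    (W : ℝ≥0 → Ω → Vec q) (X : ℝ≥0 → Ω → Vec d) (s β V : ℝ) : Prop :=
  ∀ n : ℕ, 1 ≤ n →
    ∫⁻ ω, ENNReal.ofReal
        (|P (schemeEnd Φ x T (n₀ * n) 0 (fun t => W t ω)) - P (X T ω)| ^ s) ∂μ
      ≤ ENNReal.ofReal (V * ((T : ℝ) / n₀ / n) ^ (β * s / 2))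

/-- The expansion `𝔼 P(X^h_T) - 𝔼 P(X_T) = ∑_{k ≤ L} c_k h^{α k} + o(h^{α L})` at every order
`L ≥ 1`, along `h = (T / n₀) / n`, `n → ∞`. -/
def WeakError {Ω : Type*} [MeasurableSpace Ω] {d q : ℕ} (μ : Measure Ω)
    (Φ : ℝ → Vec d → Vec q → Vec d) (x : Vec d) (T : ℝ≥0) (n₀ : ℕ) (P : Vec d → ℝ)
    (W : ℝ≥0 → Ω → Vec q) (X : ℝ≥0 → Ω → Vec d) (α : ℝ) (coef : ℕ → ℝ) : Prop :=
  ∀ L : ℕ, 1 ≤ L →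
    (fun n : ℕ =>
        (∫ ω, P (schemeEnd Φ x T (n₀ * n) 0 (fun t => W t ω)) ∂μ) - (∫ ω, P (X T ω) ∂μ)
          - ∑ k ∈ Finset.Icc 1 L, coef k * ((T : ℝ) / n₀ / n) ^ (α * k))
      =o[atTop] (fun n : ℕ => ((T : ℝ) / n₀ / n) ^ (α * L))

/-! ### Parameters of the multilevel Richardson-Romberg estimator -/

/-- The Vandermonde matrix with entries `n_j^{-α (i-1)}`, `n_j = M^{j-1}`, `1 ≤ i, j ≤ L`
(the indices of `Fin L` start at `0`). -/
def vdm (M : ℕ) (α : ℝ) (L : ℕ) : Matrix (Fin L) (Fin L) ℝ :=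
  (Matrix.vandermonde fun j : Fin L => (((M : ℝ) ^ (j : ℕ)) ^ (-α)))ᵀ

/-- The solution `w` of `V w = e₁`. -/
def smallWeight (M : ℕ) (α : ℝ) (L : ℕ) : Fin L → ℝ :=
  (vdm M α L)⁻¹ *ᵥ fun i => if (i : ℕ) = 0 then 1 else 0

/-- The weights `W̃_l = w_l + ⋯ + w_L`, `1 ≤ l ≤ L`. -/
def weight (M : ℕ) (α : ℝ) (L l : ℕ) : ℝ :=
  ∑ j : Fin L, if l ≤ (j : ℕ) + 1 then smallWeight M α L j else 0

/-- The structural parameters of the estimator: refinement factor `M`, weak rate `α`, strong rate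
`β`, coarsest step `h`, strong error constant `V₁`, variance of `P(X_T)`, and
`cInf = lim |c_L|^{1/L}`. -/
structure ML2RParams where
  M : ℕ
  α : ℝ
  β : ℝ
  h : ℝ
  V₁ : ℝ
  var : ℝ
  cInf : ℝ

namespace ML2RParams

variable (π : ML2RParams)

/-- `λ = √(V₁ / Var(P(X_T)))`. -/
def lam : ℝ := Real.sqrt (π.V₁ / π.var)

/-- `(1 + M^{β/2}) / √(1 + M⁻¹)`. -/
def cLow : ℝ := (1 + (π.M : ℝ) ^ (π.β / 2)) / Real.sqrt (1 + (π.M : ℝ)⁻¹)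

/-- `(1 + M^{β/2}) √(1 + M⁻¹)`. -/
def cUp : ℝ := (1 + (π.M : ℝ) ^ (π.β / 2)) * Real.sqrt (1 + (π.M : ℝ)⁻¹)

/-- The number of levels `L(ε)`. -/
def depth (ε : ℝ) : ℕ :=
  let a := 1 / 2 + Real.log (π.cInf ^ (1 / π.α) * π.h) / Real.log π.M
  ⌈a + Real.sqrt (a ^ 2 +
    2 * Real.log (Real.sqrt (1 + 4 * π.α) / ε) / (π.α * Real.log π.M))⌉₊

/-- The unnormalized allocation of level `l`. -/
def preAlloc (L l : ℕ) : ℝ :=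
  if l = 1 then 1 + π.lam * π.h ^ (π.β / 2)
  else π.lam * π.h ^ (π.β / 2) * π.cLow * |weight π.M π.α L l| *
    (π.M : ℝ) ^ (-((1 + π.β) / 2) * ((l : ℝ) - 1))

/-- The normalizing constant `q*`, for which `μ_1 + ⋯ + μ_L = 1`. -/
def qStar (L : ℕ) : ℝ := (∑ l ∈ Finset.Icc 1 L, π.preAlloc L l)⁻¹

/-- The allocation `μ_l`. -/
def alloc (L l : ℕ) : ℝ := π.qStar L * π.preAlloc L l

/-- The sample size `N(ε)`, for `L` levels. -/
def size (ε : ℝ) (L : ℕ) : ℝ :=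
  (1 + 1 / (2 * π.α * L)) *
    (π.var * (1 + π.lam * π.h ^ (π.β / 2) + π.lam * π.h ^ (π.β / 2) * π.cUp *
      ∑ l ∈ Finset.Icc 2 L, |weight π.M π.α L l| * (π.M : ℝ) ^ ((1 - π.β) / 2 * ((l : ℝ) - 1)))) /
    (ε ^ 2 * π.qStar L)

/-- The number of samples `N_l = ⌈N μ_l⌉` on level `l`. -/
def levelSize (ε : ℝ) (L l : ℕ) : ℕ := ⌈π.size ε L * π.alloc L l⌉₊

end ML2RParams

/-! ### The estimator -/

/-- `Ỹ_{l,θ}` as a function of the driving path `w`: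
`(P(X^{n_l}_{T,θ}) - P(X^{n_{l-1}}_{T,θ})) 𝒥⁻(w_T, θ) - m`, where the scheme of level `l` has
`n₀ M^{l-1}` steps. -/
def levelTerm {d q : ℕ} (Φ : ℝ → Vec d → Vec q → Vec d) (x : Vec d) (T : ℝ≥0) (n₀ M : ℕ)
    (P : Vec d → ℝ) (m : ℝ) (l : ℕ) (θ : Vec q) (w : ℝ≥0 → Vec q) : ℝ :=
  (P (schemeEnd Φ x T (n₀ * M ^ (l - 1)) θ w) - P (schemeEnd Φ x T (n₀ * M ^ (l - 2)) θ w)) *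
    girsanovMinus T (w T) θ - m

/-- `𝔼[P(X^{n_l}_T) - P(X^{n_{l-1}}_T)]`. -/
def levelMean {Ω : Type*} [MeasurableSpace Ω] {d q : ℕ} (μ : Measure Ω)
    (Φ : ℝ → Vec d → Vec q → Vec d) (x : Vec d) (T : ℝ≥0) (n₀ M : ℕ) (P : Vec d → ℝ)
    (W : ℝ≥0 → Ω → Vec q) (l : ℕ) : ℝ :=
  ∫ ω, (P (schemeEnd Φ x T (n₀ * M ^ (l - 1)) 0 (fun t => W t ω)) -
    P (schemeEnd Φ x T (n₀ * M ^ (l - 2)) 0 (fun t => W t ω))) ∂μ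

/-- The σ-algebra generated by the sample paths `j = 1, …, k` (of all levels) up to time `T`. -/
abbrev sampleHistory {Ω : Type*} {q : ℕ} (W : ℕ → ℕ → ℝ≥0 → Ω → Vec q) (T : ℝ≥0) (k : ℕ) :
    MeasurableSpace Ω :=
  ⨆ l : ℕ, ⨆ j ∈ Finset.Icc 1 k, ⨆ t ∈ Iic T, MeasurableSpace.comap (W l j t) inferInstance

/-- The weighted multilevel correction part
`∑_{l=2}^L (W̃_l / N_l) ∑_{k=1}^{N_l} Ỹ^k_{l, θ_l^{k-1}}` of the adaptive estimator with target
accuracy `ε`, where `m l` are the means of the levels and `L = L(ε)`, `N_l = N_l(ε)`. -/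
def correctionPart {Ω : Type*} {d q : ℕ} (π : ML2RParams) (ε : ℝ)
    (Φ : ℝ → Vec d → Vec q → Vec d) (x : Vec d) (T : ℝ≥0) (n₀ : ℕ) (P : Vec d → ℝ) (m : ℕ → ℝ)
    (θ : ℕ → ℕ → Ω → Vec q) (W : ℕ → ℕ → ℝ≥0 → Ω → Vec q) (ω : Ω) : ℝ :=
  ∑ l ∈ Finset.Icc 2 (π.depth ε),
    weight π.M π.α (π.depth ε) l / (π.levelSize ε (π.depth ε) l : ℝ) *
      ∑ k ∈ Finset.Icc 1 (π.levelSize ε (π.depth ε) l),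
        levelTerm Φ x T n₀ π.M P (m l) l (θ l (k - 1) ω) (fun t => W l k t ω)

end

/-! ### A moment inequality for sums of martingale differences -/

/-! Each summand of the estimator is centred whatever the value of its drift parameter, and its
`p`-th moment has the order of the strong error. In terms of the increments on the fine grid, adding
the drift `θ` and weighting by the likelihood ratio preserves integrals (Cameron-Martin,
`incrementLaw_withDensity_map`), so the mean of a level does not depend on `θ`. Hölder's inequality,
paid for by the strong error in the larger exponent `r`, bounds the `p`-th moment on level `l` by a
multiple of `h_{l-1}^(β p/2)`, uniformly over `‖θ‖ ≤ c` (`lintegral_weightedDiff_rpow_le`).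

The parameter of sample `k` depends only on samples with smaller number. If the pairs are ordered by
sample number first and level second, each summand is a function of a fresh path and of a parameter
determined by other paths. Freezing that parameter shows that the summand is orthogonal to every
suitably integrable function of the earlier ones. A Burkholder-type inequality
(`integral_abs_sum_rpow_le`) then lets squared `L^p` norms add up, with a constant that depends on
`p` alone; it follows from a pointwise second-order expansion of `|x + y|^p`.

What remains is deterministic: up to constants, the sum of `W̃_l² h_l^β / N_l` over the levels. The
sizes `N_l` are chosen so that it is at most `ε² / V₁` for any depth and any weights
(`sum_sq_weight_div_levelSize_le`), so neither has to be estimated. Raising to the power `p / 2`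
gives `ε^p`. -/

theorem exp_le_one_add_add_sq_mul_exp_abs (x : ℝ) :
    Real.exp x ≤ 1 + x + x ^ 2 * Real.exp |x| := by
  have h1 := Real.add_one_le_exp (-x)
  have h2 := Real.add_one_le_exp x
  have h3 : Real.exp x * Real.exp (-x) = 1 := by rw [← Real.exp_add]; simp
  have h4 := Real.exp_pos x
  have h5 : Real.exp x - 1 ≤ x * Real.exp x := by nlinarith
  have h6 : Real.exp x - 1 - x ≤ x * (Real.exp x - 1) := by linarith
  rcases le_total 0 x with hx | hx
  · rw [abs_of_nonneg hx]
    nlinarith [mul_le_mul_of_nonneg_left h5 hx]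
  · have h7 : 1 ≤ Real.exp |x| := Real.one_le_exp (abs_nonneg x)
    nlinarith [mul_le_mul_of_nonneg_left h7 (sq_nonneg x)]

theorem exists_abs_one_add_rpow_le {p : ℝ} (hp : 1 ≤ p) :
    ∃ C : ℝ, 1 ≤ C ∧ ∀ t : ℝ, |1 + t| ^ p ≤ 1 + p * t + C * (t ^ 2 + |t| ^ p) := by
  -- The term `p² eᵖ` serves `|t| ≤ 1/2`, where `1 + t ≤ eᵗ` and the second-order bound of the
  -- exponential apply. For larger `|t|`, `3ᵖ` comes from `|1 + t| ≤ 3 |t|`, and `2p` makes up for a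
  -- negative linear term.
  refine ⟨3 ^ p + 2 * p + p ^ 2 * Real.exp p, ?_, fun t => ?_⟩
  · have : (0 : ℝ) ≤ 3 ^ p := by positivity
    have : 0 ≤ p ^ 2 * Real.exp p := by positivity
    linarith
  have h3 : (0 : ℝ) ≤ 3 ^ p := by positivity
  have he : 0 ≤ p ^ 2 * Real.exp p := by positivity
  have ht : 0 ≤ |t| ^ p := by positivity
  rcases le_or_gt |t| (1 / 2) with h | h
  · have h' := abs_le.1 h
    have hpos : 0 < 1 + t := by linarith
    have hexp : |1 + t| ^ p ≤ Real.exp (p * t) := by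
      rw [abs_of_pos hpos, mul_comm, Real.exp_mul]
      apply Real.rpow_le_rpow hpos.le _ (by linarith)
      linarith [Real.add_one_le_exp t]
    have h4 := exp_le_one_add_add_sq_mul_exp_abs (p * t)
    have h5 : Real.exp |p * t| ≤ Real.exp p := by
      apply Real.exp_le_exp.2
      rw [abs_mul, abs_of_nonneg (by linarith : (0 : ℝ) ≤ p)]
      nlinarith [abs_nonneg t]
    have h6 : (p * t) ^ 2 * Real.exp |p * t| ≤ p ^ 2 * Real.exp p * t ^ 2 := by
      calc (p * t) ^ 2 * Real.exp |p * t| ≤ (p * t) ^ 2 * Real.exp p := by gcongr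
        _ = _ := by ring
    have h7 : 0 ≤ (3 ^ p + 2 * p) * t ^ 2 := by positivity
    have h8 : 0 ≤ (3 ^ p + 2 * p + p ^ 2 * Real.exp p) * |t| ^ p := by positivity
    linarith
  · have h1 : |1 + t| ≤ 3 * |t| := by
      have := abs_add_le 1 t
      rw [abs_one] at this
      linarith
    have h2 : |1 + t| ^ p ≤ 3 ^ p * |t| ^ p := by
      rw [← Real.mul_rpow (by norm_num) (abs_nonneg t)]
      exact Real.rpow_le_rpow (abs_nonneg _) h1 (by linarith)
    have h4 : -(p * t) ≤ 2 * p * t ^ 2 := by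
      have h5 : -t ≤ |t| := neg_le_abs t
      have h6 : |t| ≤ 2 * t ^ 2 := by
        rw [← sq_abs]
        nlinarith
      nlinarith
    have h7 : 0 ≤ (3 ^ p + p ^ 2 * Real.exp p) * t ^ 2 := by positivity
    have h8 : 0 ≤ (2 * p + p ^ 2 * Real.exp p) * |t| ^ p := by positivity
    linarith

/-- By homogeneity this is the case `x = 1` with `t = y / x`; only `x = 0` is separate. The linear
term is kept exactly because orthogonality will remove it after integration. -/
theorem exists_abs_add_rpow_le {p : ℝ} (hp : 2 ≤ p) :
    ∃ C : ℝ, 1 ≤ C ∧ ∀ x y : ℝ,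
      |x + y| ^ p ≤ |x| ^ p + p * (|x| ^ (p - 2) * x * y)
        + C * (|x| ^ (p - 2) * y ^ 2 + |y| ^ p) := by
  obtain ⟨C, hC, h⟩ := exists_abs_one_add_rpow_le (p := p) (by linarith)
  refine ⟨C, hC, fun x y => ?_⟩
  rcases eq_or_ne x 0 with rfl | hx
  · have h1 : 0 ≤ |(0 : ℝ)| ^ (p - 2) * y ^ 2 := by positivity
    have h2 : 0 ≤ |y| ^ p := by positivity
    have h3 : |(0 : ℝ)| ^ p = 0 := by rw [abs_zero, Real.zero_rpow (by linarith)]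
    simp only [zero_add, h3, mul_zero, zero_mul]
    nlinarith
  · have hx' : 0 < |x| := abs_pos.2 hx
    obtain ⟨t, rfl⟩ : ∃ t, y = x * t := ⟨y / x, by field_simp⟩
    have e1 : |x| ^ p = |x| ^ (p - 2) * x ^ 2 := by
      rw [← sq_abs x, ← Real.rpow_natCast |x| 2, ← Real.rpow_add hx']
      norm_num
    have e2 : |x + x * t| ^ p = |x| ^ p * |1 + t| ^ p := by
      rw [← Real.mul_rpow hx'.le (abs_nonneg _), ← abs_mul]
      ring_nf
    have e3 : |x * t| ^ p = |x| ^ p * |t| ^ p := by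
      rw [abs_mul, Real.mul_rpow hx'.le (abs_nonneg _)]
    rw [e2, e3]
    have := mul_le_mul_of_nonneg_left (h t) (by positivity : 0 ≤ |x| ^ p)
    calc _ ≤ _ := this
      _ = _ := by
        have : |x| ^ (p - 2) * x * (x * t) = |x| ^ p * t := by rw [e1]; ring
        rw [this]
        have : |x| ^ (p - 2) * (x * t) ^ 2 = |x| ^ p * t ^ 2 := by rw [e1]; ring
        rw [this]
        ring

/-- Bernoulli's inequality scaled by `a`: a convex function lies above its tangent. -/
theorem rpow_add_mul_rpow_le_add_rpow {s a u : ℝ} (hs : 1 ≤ s) (ha : 0 ≤ a) (hu : 0 ≤ u) :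
    a ^ s + s * (a ^ (s - 1) * u) ≤ (a + u) ^ s := by
  rcases hs.eq_or_lt with rfl | hs'
  · simp
  rcases ha.eq_or_lt with rfl | ha'
  · rw [Real.zero_rpow (by linarith), Real.zero_rpow (by linarith)]
    simp only [zero_mul, mul_zero, add_zero, zero_add]
    positivity
  · have h := one_add_mul_self_le_rpow_one_add (s := u / a)
      (by linarith [div_nonneg hu ha]) hs
    have e1 : (a + u) ^ s = a ^ s * (1 + u / a) ^ s := by
      rw [← Real.mul_rpow ha (by positivity)]
      congr 1
      field_simp
    have e2 : a ^ (s - 1) = a ^ s / a := by rw [Real.rpow_sub_one ha'.ne']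
    rw [e1, e2]
    calc a ^ s + s * (a ^ s / a * u) = a ^ s * (1 + s * (u / a)) := by field_simp
      _ ≤ _ := by gcongr

/-- The right side is bounded below in two ways, by the tangent and by superadditivity of the power.
Each controls one of the two error terms, and their average explains the factor 2 in front of `C`.
-/
theorem rpow_add_mul_add_le_rpow {s a b C : ℝ} (hs : 1 ≤ s) (ha : 0 ≤ a) (hb : 0 ≤ b)
    (hC : 1 ≤ C) :
    a ^ s + C * (a ^ (s - 1) * b + b ^ s) ≤ (a + 2 * C * b) ^ s := by
  have hu : 0 ≤ 2 * C * b := by positivity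
  have h1 := rpow_add_mul_rpow_le_add_rpow hs ha hu
  have h2 := Real.add_rpow_le_rpow_add ha hu hs
  have h3 : 2 * C * b ^ s ≤ (2 * C * b) ^ s := by
    rw [Real.mul_rpow (by positivity) hb]
    gcongr
    exact Real.self_le_rpow_of_one_le (by linarith) hs
  have h4 : 1 * (a ^ (s - 1) * (2 * C * b)) ≤ s * (a ^ (s - 1) * (2 * C * b)) := by gcongr
  nlinarith

section MomentInequality

variable {Ω : Type*} [MeasurableSpace Ω] {μ : Measure Ω} {p : ℝ}

theorem integrable_abs_rpow_of_memLp (hp : 0 < p) {X : Ω → ℝ}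
    (hX : MemLp X (ENNReal.ofReal p) μ) : Integrable (fun ω => |X ω| ^ p) μ := by
  have := hX.integrable_norm_rpow (by simpa using hp) (by simp)
  simpa [ENNReal.toReal_ofReal hp.le] using this

theorem rpow_mul_rpow_le_add {x y s t : ℝ} (hx : 0 ≤ x) (hy : 0 ≤ y) (hs : 0 ≤ s) (ht : 0 ≤ t) :
    x ^ s * y ^ t ≤ x ^ (s + t) + y ^ (s + t) := by
  rcases le_total x y with h | h
  · calc x ^ s * y ^ t ≤ y ^ s * y ^ t := by gcongr
      _ = y ^ (s + t) := (Real.rpow_add_of_nonneg hy hs ht).symm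
      _ ≤ _ := by linarith [Real.rpow_nonneg hx (s + t)]
  · calc x ^ s * y ^ t ≤ x ^ s * x ^ t := by gcongr
      _ = x ^ (s + t) := (Real.rpow_add_of_nonneg hx hs ht).symm
      _ ≤ _ := by linarith [Real.rpow_nonneg hy (s + t)]

theorem integrable_abs_rpow_mul_sq (hp : 2 ≤ p) {X Y : Ω → ℝ}
    (hX : MemLp X (ENNReal.ofReal p) μ) (hY : MemLp Y (ENNReal.ofReal p) μ) :
    Integrable (fun ω => |X ω| ^ (p - 2) * Y ω ^ 2) μ := by
  refine ((integrable_abs_rpow_of_memLp (by linarith) hX).add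
    (integrable_abs_rpow_of_memLp (by linarith) hY)).mono' ?_ (.of_forall fun ω => ?_)
  · have h1 := hX.1.aemeasurable
    have h2 := hY.1.aemeasurable
    exact AEMeasurable.aestronglyMeasurable (by fun_prop)
  · have := rpow_mul_rpow_le_add (abs_nonneg (X ω)) (abs_nonneg (Y ω))
      (by linarith : 0 ≤ p - 2) (by norm_num : (0 : ℝ) ≤ 2)
    rw [Real.norm_of_nonneg (by positivity), ← sq_abs (Y ω)]
    simpa using this

theorem integrable_abs_rpow_mul_mul (hp : 2 ≤ p) {X Y : Ω → ℝ}
    (hX : MemLp X (ENNReal.ofReal p) μ) (hY : MemLp Y (ENNReal.ofReal p) μ) :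
    Integrable (fun ω => |X ω| ^ (p - 2) * X ω * Y ω) μ := by
  refine ((integrable_abs_rpow_of_memLp (by linarith) hX).add
    (integrable_abs_rpow_of_memLp (by linarith) hY)).mono' ?_ (.of_forall fun ω => ?_)
  · have h1 := hX.1.aemeasurable
    have h2 := hY.1.aemeasurable
    exact AEMeasurable.aestronglyMeasurable (by fun_prop)
  · have := rpow_mul_rpow_le_add (abs_nonneg (X ω)) (abs_nonneg (Y ω))
      (by linarith : 0 ≤ p - 1) zero_le_one
    rw [norm_mul, norm_mul, Real.norm_of_nonneg (by positivity), Real.norm_eq_abs,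
      Real.norm_eq_abs]
    have e : |X ω| ^ (p - 2) * |X ω| = |X ω| ^ (p - 1) := by
      conv_lhs => rw [← Real.rpow_one |X ω|]
      rw [Real.rpow_one, ← Real.rpow_add_one' (abs_nonneg _) (by linarith)]
      ring_nf
    rw [e]
    simpa using this

/-- Hölder with weights `(p - 2) / p` and `2 / p`; written with weights instead of conjugate
exponents, it includes `p = 2`. -/
theorem integral_abs_rpow_mul_sq_le (hp : 2 ≤ p) {X Y : Ω → ℝ}
    (hX : MemLp X (ENNReal.ofReal p) μ) (hY : MemLp Y (ENNReal.ofReal p) μ) {a b : ℝ}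
    (ha : 0 ≤ a) (hb : 0 ≤ b) (hXa : ∫ ω, |X ω| ^ p ∂μ ≤ a ^ (p / 2))
    (hYb : ∫ ω, |Y ω| ^ p ∂μ ≤ b ^ (p / 2)) :
    ∫ ω, |X ω| ^ (p - 2) * Y ω ^ 2 ∂μ ≤ a ^ (p / 2 - 1) * b := by
  have hp0 : 0 < p := by linarith
  have h1 := hX.1.aemeasurable
  have h2 := hY.1.aemeasurable
  have key := ENNReal.lintegral_mul_norm_pow_le (μ := μ)
    (f := fun ω => ENNReal.ofReal (|X ω| ^ p)) (g := fun ω => ENNReal.ofReal (|Y ω| ^ p))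
    (by fun_prop) (by fun_prop) (p := (p - 2) / p) (q := 2 / p)
    (div_nonneg (by linarith) hp0.le) (by positivity) (by field_simp; ring)
  rw [← ofReal_integral_eq_lintegral_ofReal (integrable_abs_rpow_of_memLp hp0 hX)
    (.of_forall fun ω => by positivity),
    ← ofReal_integral_eq_lintegral_ofReal (integrable_abs_rpow_of_memLp hp0 hY)
    (.of_forall fun ω => by positivity)] at key
  have e : ∀ ω, ENNReal.ofReal (|X ω| ^ p) ^ ((p - 2) / p) * ENNReal.ofReal (|Y ω| ^ p) ^ (2 / p)
      = ENNReal.ofReal (|X ω| ^ (p - 2) * Y ω ^ 2) := by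
    intro ω
    rw [ENNReal.ofReal_rpow_of_nonneg (by positivity) (div_nonneg (by linarith) hp0.le),
      ENNReal.ofReal_rpow_of_nonneg (by positivity) (by positivity),
      ← ENNReal.ofReal_mul (by positivity), ← Real.rpow_mul (abs_nonneg _),
      ← Real.rpow_mul (abs_nonneg _), mul_div_cancel₀ _ hp0.ne', mul_div_cancel₀ _ hp0.ne',
      ← sq_abs (Y ω)]
    norm_num
  simp only [e] at key
  rw [← ofReal_integral_eq_lintegral_ofReal (integrable_abs_rpow_mul_sq hp hX hY)
    (.of_forall fun ω => by positivity)] at key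
  have h3 : ENNReal.ofReal (∫ ω, |X ω| ^ p ∂μ) ^ ((p - 2) / p) *
      ENNReal.ofReal (∫ ω, |Y ω| ^ p ∂μ) ^ (2 / p) ≤ ENNReal.ofReal (a ^ (p / 2 - 1) * b) := by
    calc _ ≤ ENNReal.ofReal (a ^ (p / 2)) ^ ((p - 2) / p) *
          ENNReal.ofReal (b ^ (p / 2)) ^ (2 / p) := by
          gcongr
      _ = _ := by
        rw [ENNReal.ofReal_rpow_of_nonneg (by positivity) (div_nonneg (by linarith) hp0.le),
          ENNReal.ofReal_rpow_of_nonneg (by positivity) (by positivity),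
          ← ENNReal.ofReal_mul (by positivity), ← Real.rpow_mul ha, ← Real.rpow_mul hb]
        congr 2
        · congr 1; field_simp
        · rw [show p / 2 * (2 / p) = 1 by field_simp, Real.rpow_one]
  exact (ENNReal.ofReal_le_ofReal_iff (by positivity)).1 (key.trans h3)

/-- The inequality `‖X + Y‖ₚ² ≤ ‖X‖ₚ² + 2 C ‖Y‖ₚ²` for orthogonal increments, in terms of upper
bounds `a`, `b` of `‖X‖ₚ²`, `‖Y‖ₚ²`. -/
theorem integral_abs_add_rpow_le (hp : 2 ≤ p) {C : ℝ} (hC1 : 1 ≤ C)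
    (hC : ∀ x y : ℝ, |x + y| ^ p ≤ |x| ^ p + p * (|x| ^ (p - 2) * x * y)
        + C * (|x| ^ (p - 2) * y ^ 2 + |y| ^ p)) {X Y : Ω → ℝ}
    (hX : MemLp X (ENNReal.ofReal p) μ) (hY : MemLp Y (ENNReal.ofReal p) μ) {a b : ℝ}
    (ha : 0 ≤ a) (hb : 0 ≤ b) (hXa : ∫ ω, |X ω| ^ p ∂μ ≤ a ^ (p / 2))
    (hYb : ∫ ω, |Y ω| ^ p ∂μ ≤ b ^ (p / 2))
    (h0 : ∫ ω, |X ω| ^ (p - 2) * X ω * Y ω ∂μ = 0) :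
    ∫ ω, |X ω + Y ω| ^ p ∂μ ≤ (a + 2 * C * b) ^ (p / 2) := by
  have hp0 : 0 < p := by linarith
  have i1 := integrable_abs_rpow_of_memLp hp0 hX
  have i2 := integrable_abs_rpow_of_memLp hp0 hY
  have i3 := integrable_abs_rpow_mul_sq hp hX hY
  have i4 := integrable_abs_rpow_mul_mul hp hX hY
  have i5 : Integrable (fun ω => |X ω| ^ p + p * (|X ω| ^ (p - 2) * X ω * Y ω)) μ :=
    i1.add (i4.const_mul p)
  have i6 : Integrable (fun ω => C * (|X ω| ^ (p - 2) * Y ω ^ 2 + |Y ω| ^ p)) μ :=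
    (i3.add i2).const_mul C
  have h1 := integral_abs_rpow_mul_sq_le hp hX hY ha hb hXa hYb
  calc ∫ ω, |X ω + Y ω| ^ p ∂μ
      ≤ ∫ ω, (|X ω| ^ p + p * (|X ω| ^ (p - 2) * X ω * Y ω)
        + C * (|X ω| ^ (p - 2) * Y ω ^ 2 + |Y ω| ^ p)) ∂μ :=
        integral_mono (integrable_abs_rpow_of_memLp hp0 (hX.add hY))
          (i5.add i6) fun ω => hC _ _
    _ = ∫ ω, |X ω| ^ p ∂μ + p * ∫ ω, |X ω| ^ (p - 2) * X ω * Y ω ∂μ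
        + C * (∫ ω, |X ω| ^ (p - 2) * Y ω ^ 2 ∂μ + ∫ ω, |Y ω| ^ p ∂μ) := by
        rw [integral_add i5 i6, integral_add i1 (i4.const_mul p), integral_const_mul,
          integral_const_mul, integral_add i3 i2]
    _ ≤ a ^ (p / 2) + C * (a ^ (p / 2 - 1) * b + b ^ (p / 2)) := by
        rw [h0, mul_zero, add_zero]
        gcongr
    _ ≤ _ := rpow_add_mul_add_le_rpow (by linarith) ha hb hC1

/-- A Burkholder-type inequality: `‖∑ dᵢ‖ₚ² ≤ 2 C ∑ ‖dᵢ‖ₚ²` for differences `dᵢ` that are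
orthogonal to `|S|^{p-2} S`, `S` the sum of the preceding differences. -/
theorem integral_abs_sum_rpow_le (hp : 2 ≤ p) {C : ℝ} (hC1 : 1 ≤ C)
    (hC : ∀ x y : ℝ, |x + y| ^ p ≤ |x| ^ p + p * (|x| ^ (p - 2) * x * y)
        + C * (|x| ^ (p - 2) * y ^ 2 + |y| ^ p))
    {ι : Type*} [LinearOrder ι] (s : Finset ι) {D : ι → Ω → ℝ} {b : ι → ℝ}
    (hD : ∀ i ∈ s, MemLp (D i) (ENNReal.ofReal p) μ) (hb : ∀ i ∈ s, 0 ≤ b i)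
    (hDb : ∀ i ∈ s, ∫ ω, |D i ω| ^ p ∂μ ≤ b i ^ (p / 2))
    (h0 : ∀ i ∈ s, ∀ u ⊆ s, (∀ j ∈ u, j < i) →
      ∫ ω, |∑ j ∈ u, D j ω| ^ (p - 2) * (∑ j ∈ u, D j ω) * D i ω ∂μ = 0) :
    ∫ ω, |∑ i ∈ s, D i ω| ^ p ∂μ ≤ (2 * C * ∑ i ∈ s, b i) ^ (p / 2) := by
  -- The greatest index is split off, so that the remaining sum consists of earlier differences
  -- only. Orthogonality is assumed for all subsets `u` so that it survives this induction.
  induction s using Finset.induction_on_max with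
  | empty =>
    simp only [Finset.sum_empty, abs_zero, mul_zero]
    rw [Real.zero_rpow (by linarith), Real.zero_rpow (by linarith)]
    simp
  | insert i s hi ih =>
    have his : i ∉ s := fun h => lt_irrefl i (hi i h)
    have ih' := ih (fun j hj => hD j (Finset.mem_insert_of_mem hj))
      (fun j hj => hb j (Finset.mem_insert_of_mem hj))
      (fun j hj => hDb j (Finset.mem_insert_of_mem hj))
      (fun j hj u hu => h0 j (Finset.mem_insert_of_mem hj) u
        (hu.trans (Finset.subset_insert i s)))
    have h := integral_abs_add_rpow_le hp hC1 hC
      (memLp_finsetSum s fun j hj => hD j (Finset.mem_insert_of_mem hj))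
      (hD i (Finset.mem_insert_self i s))
      (mul_nonneg (by linarith)
        (Finset.sum_nonneg fun j hj => hb j (Finset.mem_insert_of_mem hj)))
      (hb i (Finset.mem_insert_self i s)) ih' (hDb i (Finset.mem_insert_self i s))
      (h0 i (Finset.mem_insert_self i s) s (Finset.subset_insert i s) hi)
    simp only [Finset.sum_insert his]
    convert h using 2
    · simp only [add_comm]
    · ring

end MomentInequality

/-! ### Gaussian increments and change of measure -/

/-- Both measures are compared on boxes, where the integral of the product density factorizes by
independence of the coordinates. -/
theorem pi_withDensity_prod {ι : Type*} [Fintype ι] {E : ι → Type*} [∀ i, MeasurableSpace (E i)]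
    (ν : ∀ i, Measure (E i)) [∀ i, IsProbabilityMeasure (ν i)] (g : ∀ i, E i → ℝ≥0∞)
    (hg : ∀ i, Measurable (g i)) [∀ i, SigmaFinite ((ν i).withDensity (g i))] :
    (Measure.pi ν).withDensity (fun x => ∏ i, g i (x i)) =
      Measure.pi (fun i => (ν i).withDensity (g i)) := by
  refine (Measure.pi_eq fun s hs => ?_).symm
  rw [withDensity_apply _ (.univ_pi hs), ← lintegral_indicator (.univ_pi hs)]
  have hm : ∀ i, Measurable ((s i).indicator (g i)) := fun i => (hg i).indicator (hs i)
  have e : ∀ x : ∀ i, E i, (univ.pi s).indicator (fun x => ∏ i, g i (x i)) x =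
      ∏ i, (s i).indicator (g i) (x i) := by
    intro x
    by_cases hx : x ∈ univ.pi s
    · rw [indicator_of_mem hx]
      exact Finset.prod_congr rfl fun i _ => (indicator_of_mem (hx i (mem_univ i)) _).symm
    · rw [indicator_of_notMem hx]
      simp only [Set.mem_pi, mem_univ, true_imp_iff, not_forall] at hx
      obtain ⟨i, hi⟩ := hx
      exact (Finset.prod_eq_zero (Finset.mem_univ i) (indicator_of_notMem hi _)).symm
  simp only [e]
  rw [lintegral_prod_eq_prod_lintegral_of_indepFun Finset.univ
    (fun i (x : ∀ i, E i) => (s i).indicator (g i) (x i))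
    (iIndepFun_pi fun i => (hm i).aemeasurable)
    (fun i => (hm i).comp (measurable_pi_apply i))]
  refine Finset.prod_congr rfl fun i _ => ?_
  rw [withDensity_apply _ (hs i), ← lintegral_indicator (hs i),
    (measurePreserving_eval ν i).lintegral_comp (hm i)]

/-- A transport by density and shift that preserves each factor preserves the product. -/
theorem pi_withDensity_map_eq {ι : Type*} [Fintype ι] {E : ι → Type*}
    [∀ i, MeasurableSpace (E i)]
    (ν : ∀ i, Measure (E i)) [∀ i, IsProbabilityMeasure (ν i)] (g : ∀ i, E i → ℝ≥0∞)
    (hg : ∀ i, Measurable (g i)) (f : ∀ i, E i → E i) (hf : ∀ i, Measurable (f i))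
    (h : ∀ i, ((ν i).withDensity (g i)).map (f i) = ν i) :
    ((Measure.pi ν).withDensity (fun x => ∏ i, g i (x i))).map (fun x i => f i (x i)) =
      Measure.pi ν := by
  have h1 : ∀ i, IsProbabilityMeasure ((ν i).withDensity (g i)) := by
    intro i
    constructor
    have : ((ν i).withDensity (g i)).map (f i) univ = 1 := by rw [h i]; simp
    rwa [Measure.map_apply (hf i) .univ, preimage_univ] at this
  have h2 : ∀ i, SigmaFinite (((ν i).withDensity (g i)).map (f i)) := by
    intro i; rw [h i]; infer_instance
  rw [pi_withDensity_prod ν g hg, Measure.pi_map_pi fun i => (hf i).aemeasurable]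
  simp only [h]

/-- Completing the square, the density turns the centred Gaussian into the one with mean `-v a`; the
shift moves the mean back to 0. -/
theorem gaussianReal_withDensity_map (v : ℝ≥0) (hv : v ≠ 0) (a : ℝ) :
    ((gaussianReal 0 v).withDensity
      (fun x => ENNReal.ofReal (Real.exp (-(a * x) - a ^ 2 * v / 2)))).map (fun x => x + v * a) =
      gaussianReal 0 v := by
  have e : (gaussianReal 0 v).withDensity
      (fun x => ENNReal.ofReal (Real.exp (-(a * x) - a ^ 2 * v / 2))) =
      gaussianReal (-(v * a)) v := by
    rw [gaussianReal_of_var_ne_zero _ hv, gaussianReal_of_var_ne_zero _ hv,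
      ← withDensity_mul _ (measurable_gaussianPDF _ _) (by fun_prop)]
    congr 1
    ext x
    rw [Pi.mul_apply, gaussianPDF, gaussianPDF, ← ENNReal.ofReal_mul (gaussianPDFReal_nonneg _ _ _),
      gaussianPDFReal, gaussianPDFReal, mul_assoc, ← Real.exp_add]
    congr 3
    have : (v : ℝ) ≠ 0 := by exact_mod_cast hv
    field_simp
    ring
  rw [e, gaussianReal_map_add_const]
  simp

/-- The law of the increments of a `q`-dimensional Brownian motion over `n` time steps of
length `v`. -/
noncomputable def incrementLaw (q n : ℕ) (v : ℝ≥0) : Measure (Fin q → Fin n → ℝ) :=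
  Measure.pi fun _ => Measure.pi fun _ => gaussianReal 0 v

instance (q n : ℕ) (v : ℝ≥0) : IsProbabilityMeasure (incrementLaw q n v) := by
  unfold incrementLaw; infer_instance

/-- The logarithm of the density of the increments shifted by `-v θ`. -/
noncomputable def logDensity {q n : ℕ} (v : ℝ≥0) (θ : Vec q) (z : Fin q → Fin n → ℝ) : ℝ :=
  -(∑ j, θ j * ∑ i, z j i) - ‖θ‖ ^ 2 * (n * v) / 2

/-- The increments after adding the drift `θ`. -/
def driftShift {q n : ℕ} (v : ℝ≥0) (θ : Vec q) (z : Fin q → Fin n → ℝ) : Fin q → Fin n → ℝ :=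
  fun j i => z j i + v * θ j

theorem logDensity_eq_sum {q n : ℕ} (v : ℝ≥0) (θ : Vec q) (z : Fin q → Fin n → ℝ) :
    logDensity v θ z = ∑ j, ∑ i, (-(θ j * z j i) - θ j ^ 2 * v / 2) := by
  simp only [logDensity, Finset.sum_sub_distrib, Finset.sum_neg_distrib, ← Finset.mul_sum,
    EuclideanSpace.real_norm_sq_eq, Finset.sum_const, Finset.card_univ, Fintype.card_fin,
    nsmul_eq_mul]
  rw [Finset.sum_mul, Finset.sum_div, Finset.mul_sum, sub_right_inj]
  exact Finset.sum_congr rfl fun j _ => by ring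

@[fun_prop]
theorem measurable_logDensity {q n : ℕ} (v : ℝ≥0) :
    Measurable fun y : Vec q × (Fin q → Fin n → ℝ) => logDensity v y.1 y.2 := by
  unfold logDensity
  fun_prop

@[fun_prop]
theorem measurable_driftShift {q n : ℕ} (v : ℝ≥0) :
    Measurable fun y : Vec q × (Fin q → Fin n → ℝ) => driftShift v y.1 y.2 := by
  unfold driftShift
  fun_prop

/-- The Cameron-Martin formula for finitely many increments. -/
theorem incrementLaw_withDensity_map {q n : ℕ} {v : ℝ≥0} (hv : v ≠ 0) (θ : Vec q) :
    ((incrementLaw q n v).withDensity fun z => ENNReal.ofReal (Real.exp (logDensity v θ z))).map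
      (driftShift v θ) = incrementLaw q n v := by
  -- The product principle is used twice, over the coordinates and, inside each, over the time
  -- steps.
  have h := pi_withDensity_map_eq (fun _ : Fin q => Measure.pi fun _ : Fin n => gaussianReal 0 v)
    (fun j y => ∏ i, ENNReal.ofReal (Real.exp (-(θ j * y i) - θ j ^ 2 * v / 2)))
    (fun j => by fun_prop) (fun j y i => y i + v * θ j) (fun j => by fun_prop)
    (fun j => pi_withDensity_map_eq (fun _ : Fin n => gaussianReal 0 v)
      (fun i x => ENNReal.ofReal (Real.exp (-(θ j * x) - θ j ^ 2 * v / 2)))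
      (fun i => by fun_prop) (fun i x => x + v * θ j) (fun i => by fun_prop)
      (fun i => gaussianReal_withDensity_map v hv (θ j)))
  refine Eq.trans (congrArg (Measure.map _) ?_) h
  refine congrArg (Measure.withDensity _) (funext fun z => ?_)
  rw [logDensity_eq_sum, Real.exp_sum, ENNReal.ofReal_prod_of_nonneg (fun _ _ => by positivity)]
  refine Finset.prod_congr rfl fun j _ => ?_
  rw [Real.exp_sum, ENNReal.ofReal_prod_of_nonneg (fun _ _ => by positivity)]

theorem lintegral_driftShift_mul {q n : ℕ} {v : ℝ≥0} (hv : v ≠ 0) (θ : Vec q)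
    {f : (Fin q → Fin n → ℝ) → ℝ≥0∞} (hf : Measurable f) :
    ∫⁻ z, f (driftShift v θ z) * ENNReal.ofReal (Real.exp (logDensity v θ z)) ∂incrementLaw q n v =
      ∫⁻ z, f z ∂incrementLaw q n v := by
  have hs : Measurable (driftShift (n := n) v θ) := by fun_prop
  have hl : Measurable (logDensity (n := n) v θ) := by fun_prop
  conv_rhs => rw [← incrementLaw_withDensity_map hv θ]
  rw [lintegral_map hf hs, lintegral_withDensity_eq_lintegral_mul _ (by fun_prop) (by fun_prop)]
  exact lintegral_congr fun z => mul_comm _ _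

theorem integral_driftShift_mul {q n : ℕ} {v : ℝ≥0} (hv : v ≠ 0) (θ : Vec q)
    {f : (Fin q → Fin n → ℝ) → ℝ} (hf : Measurable f) :
    ∫ z, f (driftShift v θ z) * Real.exp (logDensity v θ z) ∂incrementLaw q n v =
      ∫ z, f z ∂incrementLaw q n v := by
  have hs : Measurable (driftShift (n := n) v θ) := by fun_prop
  have hl : Measurable (logDensity (n := n) v θ) := by fun_prop
  conv_rhs => rw [← incrementLaw_withDensity_map hv θ]
  rw [integral_map hs.aemeasurable hf.aestronglyMeasurable,
    integral_withDensity_eq_integral_toReal_smul (by fun_prop) (by simp)]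
  refine integral_congr_ae (.of_forall fun z => ?_)
  simp only [ENNReal.toReal_ofReal (Real.exp_pos _).le, smul_eq_mul]
  exact mul_comm _ _

/-- The Gaussian exponential moment needs no computation: it says that the shifted density has total
mass 1. -/
theorem lintegral_exp_sum_increments {q n : ℕ} {v : ℝ≥0} (hv : v ≠ 0) (θ : Vec q) :
    ∫⁻ z, ENNReal.ofReal (Real.exp (-∑ j, θ j * ∑ i, z j i)) ∂incrementLaw q n v =
      ENNReal.ofReal (Real.exp (‖θ‖ ^ 2 * (n * v) / 2)) := by
  have h := lintegral_driftShift_mul (n := n) hv θ (f := fun _ => 1) measurable_const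
  have hl : Measurable (logDensity (n := n) v θ) := by fun_prop
  have e : ∀ z : Fin q → Fin n → ℝ, ENNReal.ofReal (Real.exp (-∑ j, θ j * ∑ i, z j i)) =
      ENNReal.ofReal (Real.exp (‖θ‖ ^ 2 * (n * v) / 2)) *
        ENNReal.ofReal (Real.exp (logDensity v θ z)) := by
    intro z
    rw [← ENNReal.ofReal_mul (by positivity), ← Real.exp_add, logDensity]
    congr 2
    ring
  simp only [one_mul, lintegral_one, measure_univ] at h
  simp only [e]
  rw [lintegral_const_mul _ (by fun_prop), h, mul_one]

/-- The moments of `f` weighted by the density after the drift shift, bounded through Hölder's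
inequality by a higher moment of `f`. -/
theorem lintegral_driftShift_mul_rpow_le {q n : ℕ} {v : ℝ≥0} (hv : v ≠ 0) {p r c : ℝ}
    (hp : 1 ≤ p) (hr : p < r) {θ : Vec q} (hθ : ‖θ‖ ≤ c)
    {f : (Fin q → Fin n → ℝ) → ℝ} (hf : Measurable f) :
    ∫⁻ z, ENNReal.ofReal (|f (driftShift v θ z) * Real.exp (logDensity v θ z)| ^ p)
        ∂incrementLaw q n v ≤
      (∫⁻ z, ENNReal.ofReal (|f z| ^ r) ∂incrementLaw q n v) ^ (p / r) *
        ENNReal.ofReal (Real.exp ((((p - 1) * r / (r - p)) ^ 2 + (p - 1) * r / (r - p)) *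
          c ^ 2 * (n * v) / 2)) ^ (1 - p / r) := by
  have hr0 : 0 < r := by linarith
  have hrp : 0 < r - p := by linarith
  -- Of the `p`-th power of the density, one factor is used up by the change of measure. The other
  -- `p - 1` become `g ^ (1 - p / r)`, the second Hölder factor, which forces `κ (1 - p / r) = p -
  -- 1`.
  set κ : ℝ := (p - 1) * r / (r - p) with hκ
  have hκ0 : 0 ≤ κ := div_nonneg (mul_nonneg (by linarith) hr0.le) hrp.le
  have hw : 0 ≤ 1 - p / r := by rw [sub_nonneg, div_le_one hr0]; exact hr.le
  let g : (Fin q → Fin n → ℝ) → ℝ :=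
    fun z => Real.exp (κ * (-(∑ j, θ j * ∑ i, z j i) + ‖θ‖ ^ 2 * (n * v) / 2))
  have hg : Measurable g := by fun_prop
  have hκw : κ * (1 - p / r) = p - 1 := by
    rw [hκ]; field_simp
  have e1 : ∀ z : Fin q → Fin n → ℝ,
      ENNReal.ofReal (|f (driftShift v θ z) * Real.exp (logDensity v θ z)| ^ p) =
      ENNReal.ofReal (|f (driftShift v θ z)| ^ p * g (driftShift v θ z) ^ (1 - p / r)) *
        ENNReal.ofReal (Real.exp (logDensity v θ z)) := by
    intro z
    rw [← ENNReal.ofReal_mul (by positivity), abs_mul, Real.abs_exp,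
      Real.mul_rpow (abs_nonneg _) (by positivity), ← Real.exp_mul, mul_assoc]
    congr 2
    simp only [g]
    rw [← Real.exp_mul, ← Real.exp_add]
    congr 1
    -- The shift contributes `-‖θ‖² n v` to the linear part. Hence the quadratic term of `g` carries
    -- the sign opposite to that in `logDensity`.
    have e2 : -(∑ j, θ j * ∑ i, driftShift v θ z j i) + ‖θ‖ ^ 2 * (n * v) / 2 =
        logDensity v θ z := by
      simp only [driftShift, logDensity, Finset.sum_add_distrib, Finset.sum_const,
        Finset.card_univ, Fintype.card_fin, nsmul_eq_mul, mul_add, EuclideanSpace.real_norm_sq_eq]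
      have : ∑ j, θ j * (n * (v * θ j)) = (∑ j, θ j ^ 2) * (n * v) := by
        rw [Finset.sum_mul]
        exact Finset.sum_congr rfl fun j _ => by ring
      rw [this]
      ring
    rw [e2, mul_right_comm, hκw]
    ring
  simp only [e1]
  rw [lintegral_driftShift_mul hv θ
    (f := fun z => ENNReal.ofReal (|f z| ^ p * g z ^ (1 - p / r))) (by fun_prop)]
  have e3 : ∀ z, ENNReal.ofReal (|f z| ^ p * g z ^ (1 - p / r)) =
      ENNReal.ofReal (|f z| ^ r) ^ (p / r) * ENNReal.ofReal (g z) ^ (1 - p / r) := by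
    intro z
    rw [ENNReal.ofReal_rpow_of_nonneg (by positivity) (by positivity),
      ENNReal.ofReal_rpow_of_nonneg (by positivity) hw, ← ENNReal.ofReal_mul (by positivity),
      ← Real.rpow_mul (abs_nonneg _), mul_div_cancel₀ _ hr0.ne']
  simp only [e3]
  refine (ENNReal.lintegral_mul_norm_pow_le (by fun_prop) (by fun_prop) (by positivity) hw
    (by ring)).trans ?_
  gcongr
  have e4 : ∀ z : Fin q → Fin n → ℝ, ENNReal.ofReal (g z) =
      ENNReal.ofReal (Real.exp (κ * ‖θ‖ ^ 2 * (n * v) / 2)) *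
        ENNReal.ofReal (Real.exp (-∑ j, (κ • θ) j * ∑ i, z j i)) := by
    intro z
    rw [← ENNReal.ofReal_mul (by positivity), ← Real.exp_add]
    simp only [g, PiLp.smul_apply, smul_eq_mul, mul_assoc, ← Finset.mul_sum]
    congr 2
    ring
  simp only [e4]
  rw [lintegral_const_mul _ (by fun_prop), lintegral_exp_sum_increments hv,
    ← ENNReal.ofReal_mul (by positivity), ← Real.exp_add]
  gcongr
  rw [norm_smul, Real.norm_of_nonneg hκ0]
  have : ‖θ‖ ^ 2 ≤ c ^ 2 := by gcongr
  have h5 : (κ ^ 2 + κ) * ‖θ‖ ^ 2 * (n * v) / 2 ≤ (κ ^ 2 + κ) * c ^ 2 * (n * v) / 2 := by gcongr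
  calc _ = (κ ^ 2 + κ) * ‖θ‖ ^ 2 * (n * v) / 2 := by ring
    _ ≤ _ := h5

section BrownianIncrements

variable {Ω : Type*} [MeasurableSpace Ω] {μ : Measure Ω} {q : ℕ}

/-- The increments of the path `w` over the grid `i T / n`. -/
noncomputable def pathIncrements {q : ℕ} (T : ℝ≥0) (n : ℕ) (w : ℝ≥0 → Vec q) :
    Fin q → Fin n → ℝ :=
  fun j i => w (((i : ℕ) + 1 : ℝ≥0) * T / n) j - w (((i : ℕ) : ℝ≥0) * T / n) j

theorem measurable_pathIncrements (T : ℝ≥0) (n : ℕ) :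
    Measurable (pathIncrements T n : (ℝ≥0 → Vec q) → Fin q → Fin n → ℝ) := by
  unfold pathIncrements
  fun_prop

theorem map_pathIncrements [IsProbabilityMeasure μ] {W : ℝ≥0 → Ω → Vec q}
    (hW : IsBrownianMotion W μ) (T : ℝ≥0) (n : ℕ) :
    μ.map (fun ω => pathIncrements T n fun t => W t ω) = incrementLaw q n (T / n) := by
  have hm := hW.measurable
  let f : (ℝ≥0 → ℝ) → Fin n → ℝ :=
    fun y i => y (((i : ℕ) + 1 : ℝ≥0) * T / n) - y (((i : ℕ) : ℝ≥0) * T / n)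
  have hf : Measurable f := by fun_prop
  have h1 := (iIndepFun_iff_map_fun_eq_pi_map
    (fun j => (hf.comp (by fun_prop)).aemeasurable)).1
    (hW.indep.comp (fun _ => f) fun _ => hf)
  refine h1.trans ?_
  unfold incrementLaw
  congr 1
  ext1 j
  have hI : iIndepFun (fun (i : Fin n) ω => W (((i : ℕ) + 1 : ℝ≥0) * T / n) ω j -
      W (((i : ℕ) : ℝ≥0) * T / n) ω j) μ := by
    have := (hW.coord j).toIsPreBrownianReal.hasIndepIncrements n
      (fun i => ((i : ℕ) : ℝ≥0) * T / n) (fun a b hab => by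
        have : ((a : ℕ) : ℝ≥0) ≤ (b : ℕ) := by exact_mod_cast hab
        dsimp only
        gcongr)
    simpa using this
  have h2 := (iIndepFun_iff_map_fun_eq_pi_map (fun i => by fun_prop)).1 hI
  refine h2.trans ?_
  congr 1
  ext1 i
  have h3 := ((hW.coord j).toIsPreBrownianReal.hasLaw_sub (((i : ℕ) + 1 : ℝ≥0) * T / n)
    (((i : ℕ) : ℝ≥0) * T / n)).map_eq
  have h4 : nndist (((((i : ℕ) + 1 : ℝ≥0) * T / n : ℝ≥0)) : ℝ)
      ((((i : ℕ) : ℝ≥0) * T / n : ℝ≥0) : ℝ) = T / n := by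
    ext
    rw [coe_nndist, Real.dist_eq]
    push_cast
    rw [← sub_div, ← sub_mul, add_sub_cancel_left, one_mul, abs_of_nonneg (by positivity)]
  erw [h4] at h3
  exact h3

end BrownianIncrements

/-! ### The schemes as functions of the increments on the fine grid -/

section Scheme

variable {d q : ℕ}

theorem schemePath_congr (Φ : ℝ → Vec d → Vec q → Vec d) (x : Vec d) (T : ℝ≥0) (n : ℕ)
    {θ θ' : Vec q} {w w' : ℝ≥0 → Vec q} {k : ℕ}
    (h : ∀ i < k, w (((i : ℝ≥0) + 1) * T / n) - w ((i : ℝ≥0) * T / n) + ((T : ℝ) / n) • θ =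
      w' (((i : ℝ≥0) + 1) * T / n) - w' ((i : ℝ≥0) * T / n) + ((T : ℝ) / n) • θ') :
    schemePath Φ x T n θ w k = schemePath Φ x T n θ' w' k := by
  induction k with
  | zero => rfl
  | succ k ih =>
    rw [schemePath, schemePath, ih fun i hi => h i (by omega), h k (by omega)]

/-- The step path with the increments `z` over the grid `i T / n`. -/
noncomputable def stepPath (T : ℝ≥0) (n : ℕ) (z : Fin q → Fin n → ℝ) (t : ℝ≥0) : Vec q :=
  WithLp.toLp 2 fun j => ∑ i : Fin n, if (((i : ℕ) : ℝ≥0) + 1) * T / n ≤ t then z j i else 0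

theorem measurable_stepPath (T : ℝ≥0) (n : ℕ) (t : ℝ≥0) :
    Measurable fun z : Fin q → Fin n → ℝ => stepPath T n z t := by
  unfold stepPath
  refine (WithLp.measurable_toLp 2 _).comp (measurable_pi_lambda _ fun j => ?_)
  refine Finset.measurable_fun_sum _ fun i _ => ?_
  split_ifs <;> fun_prop

theorem measurable_schemePath_stepPath {Φ : ℝ → Vec d → Vec q → Vec d}
    (hΦ : ∀ h, Measurable fun z : Vec d × Vec q => Φ h z.1 z.2) (x : Vec d) (T : ℝ≥0)
    (n m k : ℕ) :
    Measurable fun z : Fin q → Fin n → ℝ => schemePath Φ x T m 0 (stepPath T n z) k := by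
  induction k with
  | zero => exact measurable_const
  | succ k ih =>
    have h1 := measurable_stepPath (q := q) T n (((k : ℝ≥0) + 1) * T / m)
    have h2 := measurable_stepPath (q := q) T n ((k : ℝ≥0) * T / m)
    exact (hΦ ((T : ℝ) / m)).comp (ih.prodMk ((h1.sub h2).add_const _))

/-- The step path jumps at the right end of each cell, so at the `k`-th grid point exactly the first
`k` increments have been added and the sum telescopes. -/
theorem stepPath_driftShift_pathIncrements {T : ℝ≥0} (hT : 0 < T) {n : ℕ} (hn : 1 ≤ n)
    (θ : Vec q) (w : ℝ≥0 → Vec q) {k : ℕ} (hk : k ≤ n) :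
    stepPath T n (driftShift (T / n) θ (pathIncrements T n w)) ((k : ℝ≥0) * T / n) =
      w ((k : ℝ≥0) * T / n) - w 0 + ((k : ℝ) * (T / n)) • θ := by
  have hn' : (0 : ℝ≥0) < n := by exact_mod_cast hn
  ext j
  simp only [stepPath, driftShift, pathIncrements, PiLp.add_apply, PiLp.sub_apply,
    PiLp.smul_apply, smul_eq_mul]
  have hcond : ∀ i : Fin n, ((((i : ℕ) : ℝ≥0) + 1) * T / n ≤ (k : ℝ≥0) * T / n) ↔ (i : ℕ) < k := by
    intro i
    rw [div_le_div_iff_of_pos_right hn', mul_le_mul_iff_left₀ hT, ← Nat.cast_add_one, Nat.cast_le,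
      Nat.add_one_le_iff]
  simp only [hcond]
  rw [Fin.sum_univ_eq_sum_range (fun i => if i < k then
    w (((i : ℝ≥0) + 1) * T / n) j - w ((i : ℝ≥0) * T / n) j + ((T / n : ℝ≥0) : ℝ) * θ j else 0) n,
    ← Finset.sum_filter]
  have hfil : (Finset.range n).filter (· < k) = Finset.range k := by
    ext i; simp only [Finset.mem_filter, Finset.mem_range]; omega
  rw [hfil, Finset.sum_add_distrib]
  have := Finset.sum_range_sub (fun i : ℕ => w ((i : ℝ≥0) * T / n) j) k
  simp only [Nat.cast_add, Nat.cast_one, Nat.cast_zero, zero_mul, zero_div] at this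
  rw [this]
  simp
  ring

/-- A scheme on a coarser grid, with drift `θ`, is the driftless scheme for the path with the
shifted fine increments. -/
theorem schemeEnd_eq_stepPath (Φ : ℝ → Vec d → Vec q → Vec d) (x : Vec d) {T : ℝ≥0} (hT : 0 < T)
    {m M n : ℕ} (hm : 1 ≤ m) (hM : 1 ≤ M) (hn : n = m * M) (θ : Vec q) (w : ℝ≥0 → Vec q) :
    schemeEnd Φ x T m θ w =
      schemeEnd Φ x T m 0 (stepPath T n (driftShift (T / n) θ (pathIncrements T n w))) := by
  have hm' : (m : ℝ≥0) ≠ 0 := by exact_mod_cast (by omega : m ≠ 0)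
  have hM' : (M : ℝ≥0) ≠ 0 := by exact_mod_cast (by omega : M ≠ 0)
  -- The coarse grid consists of every `M`-th fine point, so a coarse step collects `M` fine drifts,
  -- in total `(T / m) • θ`.
  have hgrid : ∀ i : ℕ, (i : ℝ≥0) * T / m = ((i * M : ℕ) : ℝ≥0) * T / n := by
    intro i
    rw [hn]
    push_cast
    field_simp
  refine schemePath_congr Φ x T m fun i hi => ?_
  have hn1 : 1 ≤ n := by rw [hn]; exact Nat.mul_pos hm hM
  have h1 : (i + 1) * M ≤ n := by rw [hn]; exact Nat.mul_le_mul_right M hi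
  have h2 : i * M ≤ n := (Nat.mul_le_mul_right M (Nat.le_succ i)).trans h1
  have e := hgrid (i + 1)
  push_cast at e
  have e' := hgrid i
  push_cast at e'
  have s1 := stepPath_driftShift_pathIncrements hT hn1 θ w h1
  have s2 := stepPath_driftShift_pathIncrements hT hn1 θ w h2
  push_cast at s1 s2
  rw [e, e', s1, s2, smul_zero, add_zero, add_sub_add_comm, ← sub_smul, sub_sub_sub_cancel_right]
  congr 2
  have hm'' : (m : ℝ) ≠ 0 := by exact_mod_cast (by omega : m ≠ 0)
  have hM'' : (M : ℝ) ≠ 0 := by exact_mod_cast (by omega : M ≠ 0)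
  rw [hn]
  push_cast
  field_simp
  ring

theorem girsanovMinus_eq_exp_logDensity {T : ℝ≥0} {n : ℕ} (hn : 1 ≤ n) (θ : Vec q)
    {w : ℝ≥0 → Vec q} (h0 : w 0 = 0) :
    girsanovMinus T (w T) θ = Real.exp (logDensity (T / n) θ (pathIncrements T n w)) := by
  have hn0 : (n : ℝ≥0) ≠ 0 := by exact_mod_cast (by omega : n ≠ 0)
  have hn0' : (n : ℝ) ≠ 0 := by exact_mod_cast (by omega : n ≠ 0)
  have e : ∀ j, ∑ i, pathIncrements T n w j i = w T j := by
    intro j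
    unfold pathIncrements
    rw [Fin.sum_univ_eq_sum_range (fun i : ℕ =>
      w (((i : ℝ≥0) + 1) * T / n) j - w ((i : ℝ≥0) * T / n) j) n]
    have := Finset.sum_range_sub (fun i : ℕ => w ((i : ℝ≥0) * T / n) j) n
    simp only [Nat.cast_add, Nat.cast_one, Nat.cast_zero, zero_mul, zero_div] at this
    rw [this, h0, mul_div_cancel_left₀ _ hn0]
    simp
  simp only [girsanovMinus, logDensity, e]
  congr 2
  · simp [PiLp.inner_apply, mul_comm]
  · push_cast
    rw [mul_div_cancel₀ _ hn0']

/-- The difference of the payoffs of the schemes with `n` and `m` steps, as a function of the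
increments on the grid with `n` steps. -/
noncomputable def payoffDiff (Φ : ℝ → Vec d → Vec q → Vec d) (x : Vec d) (T : ℝ≥0)
    (P : Vec d → ℝ) (n m : ℕ) (z : Fin q → Fin n → ℝ) : ℝ :=
  P (schemeEnd Φ x T n 0 (stepPath T n z)) - P (schemeEnd Φ x T m 0 (stepPath T n z))

theorem measurable_payoffDiff {Φ : ℝ → Vec d → Vec q → Vec d}
    (hΦ : ∀ h, Measurable fun z : Vec d × Vec q => Φ h z.1 z.2) (x : Vec d) (T : ℝ≥0)
    {P : Vec d → ℝ} (hP : Measurable P) (n m : ℕ) :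
    Measurable (payoffDiff Φ x T P n m) :=
  (hP.comp (measurable_schemePath_stepPath hΦ x T n n n)).sub
    (hP.comp (measurable_schemePath_stepPath hΦ x T n m m))

theorem payoffDiff_driftShift (Φ : ℝ → Vec d → Vec q → Vec d) (x : Vec d) {T : ℝ≥0} (hT : 0 < T)
    (P : Vec d → ℝ) {m M n : ℕ} (hm : 1 ≤ m) (hM : 1 ≤ M) (hn : n = m * M) (θ : Vec q)
    (w : ℝ≥0 → Vec q) :
    payoffDiff Φ x T P n m (driftShift (T / n) θ (pathIncrements T n w)) =
      P (schemeEnd Φ x T n θ w) - P (schemeEnd Φ x T m θ w) := by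
  rw [payoffDiff, ← schemeEnd_eq_stepPath Φ x hT hm hM hn,
    ← schemeEnd_eq_stepPath Φ x hT (hn ▸ Nat.mul_pos hm hM) le_rfl (mul_one n).symm]

theorem driftShift_zero {n : ℕ} (v : ℝ≥0) (z : Fin q → Fin n → ℝ) : driftShift v 0 z = z := by
  ext j i
  simp [driftShift]

/-- The weighted payoff difference `(P(X^n_{T,θ}) - P(X^m_{T,θ})) 𝒥⁻` as a function of the
increments on the grid with `n` steps. -/
noncomputable def weightedDiff (Φ : ℝ → Vec d → Vec q → Vec d) (x : Vec d) (T : ℝ≥0)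
    (P : Vec d → ℝ) (n m : ℕ) (θ : Vec q) (z : Fin q → Fin n → ℝ) : ℝ :=
  payoffDiff Φ x T P n m (driftShift (T / n) θ z) * Real.exp (logDensity (T / n) θ z)

theorem measurable_weightedDiff_right {Φ : ℝ → Vec d → Vec q → Vec d}
    (hΦ : ∀ h, Measurable fun z : Vec d × Vec q => Φ h z.1 z.2) (x : Vec d) (T : ℝ≥0)
    {P : Vec d → ℝ} (hP : Measurable P) (n m : ℕ) (θ : Vec q) :
    Measurable (weightedDiff Φ x T P n m θ) := by
  have h1 : Measurable (driftShift (n := n) (T / n) θ) := by fun_prop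
  have h2 : Measurable (logDensity (n := n) (T / n) θ) := by fun_prop
  exact ((measurable_payoffDiff hΦ x T hP n m).comp h1).mul (Real.measurable_exp.comp h2)

theorem levelTerm_eq_weightedDiff (Φ : ℝ → Vec d → Vec q → Vec d) (x : Vec d) {T : ℝ≥0}
    (hT : 0 < T) {n₀ M : ℕ} (hn₀ : 1 ≤ n₀) (hM : 1 ≤ M) (P : Vec d → ℝ) (a : ℝ) {l : ℕ}
    (hl : 2 ≤ l) (θ : Vec q) {w : ℝ≥0 → Vec q} (h0 : w 0 = 0) :
    levelTerm Φ x T n₀ M P a l θ w =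
      weightedDiff Φ x T P (n₀ * M ^ (l - 1)) (n₀ * M ^ (l - 2)) θ
        (pathIncrements T (n₀ * M ^ (l - 1)) w) - a := by
  have hm : 1 ≤ n₀ * M ^ (l - 2) := Nat.mul_pos hn₀ (Nat.pow_pos hM)
  have hn : 1 ≤ n₀ * M ^ (l - 1) := Nat.mul_pos hn₀ (Nat.pow_pos hM)
  have e : n₀ * M ^ (l - 1) = n₀ * M ^ (l - 2) * M := by
    rw [mul_assoc, ← pow_succ]
    congr 2
    omega
  rw [levelTerm, weightedDiff, payoffDiff_driftShift Φ x hT P hm hM e,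
    girsanovMinus_eq_exp_logDensity hn θ h0]

end Scheme

/-! ### Moments of the level terms -/

section LevelMoments

variable {d q : ℕ} {Ω₀ : Type*} [MeasurableSpace Ω₀] {μ₀ : Measure Ω₀} [IsProbabilityMeasure μ₀]

theorem abs_sub_rpow_le {r : ℝ} (hr : 0 ≤ r) (a b e : ℝ) :
    |a - b| ^ r ≤ 2 ^ r * (|a - e| ^ r + |b - e| ^ r) := by
  have h : |a - b| ≤ 2 * max |a - e| |b - e| := by
    have h1 := abs_sub_le a e b
    rw [abs_sub_comm e b] at h1
    linarith [le_max_left |a - e| |b - e|, le_max_right |a - e| |b - e|]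
  calc |a - b| ^ r ≤ (2 * max |a - e| |b - e|) ^ r := Real.rpow_le_rpow (abs_nonneg _) h hr
    _ = 2 ^ r * max |a - e| |b - e| ^ r :=
      Real.mul_rpow (by norm_num) (le_max_of_le_left (abs_nonneg _))
    _ ≤ _ := by
      gcongr
      rcases max_cases |a - e| |b - e| with ⟨h, _⟩ | ⟨h, _⟩ <;> rw [h]
      · linarith [Real.rpow_nonneg (abs_nonneg (b - e)) r]
      · linarith [Real.rpow_nonneg (abs_nonneg (a - e)) r]

/-- Both schemes are compared with `X T`, and the error of the finer one is relaxed to the step size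
of the coarser one. -/
theorem lintegral_payoffDiff_rpow_le {Φ : ℝ → Vec d → Vec q → Vec d}
    (hΦ : ∀ h, Measurable fun z : Vec d × Vec q => Φ h z.1 z.2) (x : Vec d) {T : ℝ≥0}
    (hT : 0 < T) {n₀ M : ℕ} (hn₀ : 1 ≤ n₀) (hM : 1 ≤ M) {P : Vec d → ℝ} (hP : Measurable P)
    {W₀ : ℝ≥0 → Ω₀ → Vec q} (hW : IsBrownianMotion W₀ μ₀) {X : ℝ≥0 → Ω₀ → Vec d}
    (hX : Measurable (X T)) {r β V : ℝ} (hr : 0 < r) (hβ : 0 < β) (hV : 0 < V)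
    (hS : StrongError μ₀ Φ x T n₀ P W₀ X r β V) {l : ℕ} (hl : 2 ≤ l) :
    ∫⁻ z, ENNReal.ofReal (|payoffDiff Φ x T P (n₀ * M ^ (l - 1)) (n₀ * M ^ (l - 2)) z| ^ r)
        ∂incrementLaw q (n₀ * M ^ (l - 1)) (T / (n₀ * M ^ (l - 1) : ℕ)) ≤
      ENNReal.ofReal (2 ^ (r + 1) * V * ((T : ℝ) / n₀ / (M : ℝ) ^ (l - 2)) ^ (β * r / 2)) := by
  have hm : 1 ≤ n₀ * M ^ (l - 2) := Nat.mul_pos hn₀ (Nat.pow_pos hM)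
  have e : n₀ * M ^ (l - 1) = n₀ * M ^ (l - 2) * M := by
    rw [mul_assoc, ← pow_succ]
    congr 2
    omega
  have hPD := measurable_payoffDiff hΦ x T hP (n₀ * M ^ (l - 1)) (n₀ * M ^ (l - 2))
  have hZ : Measurable fun ω => pathIncrements T (n₀ * M ^ (l - 1)) fun t => W₀ t ω :=
    (measurable_pathIncrements T _).comp (measurable_pi_lambda _ hW.measurable)
  rw [← map_pathIncrements hW T (n₀ * M ^ (l - 1)),
    lintegral_map (by fun_prop) hZ]
  have hval : ∀ w : ℝ≥0 → Vec q, payoffDiff Φ x T P (n₀ * M ^ (l - 1)) (n₀ * M ^ (l - 2))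
      (pathIncrements T (n₀ * M ^ (l - 1)) w) =
      P (schemeEnd Φ x T (n₀ * M ^ (l - 1)) 0 w) - P (schemeEnd Φ x T (n₀ * M ^ (l - 2)) 0 w) := by
    intro w
    rw [← payoffDiff_driftShift Φ x hT P hm hM e 0 w, driftShift_zero]
  simp only [hval]
  have h1 := hS (M ^ (l - 1)) (Nat.pow_pos hM)
  have h2 := hS (M ^ (l - 2)) (Nat.pow_pos hM)
  have hmeas : Measurable fun ω =>
      P (schemeEnd Φ x T (n₀ * M ^ (l - 1)) 0 fun t => W₀ t ω) - P (X T ω) := by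
    have hs : Measurable fun ω =>
        P (schemeEnd Φ x T (n₀ * M ^ (l - 1)) 0 fun t => W₀ t ω) := by
      have hn : 1 ≤ n₀ * M ^ (l - 1) := Nat.mul_pos hn₀ (Nat.pow_pos hM)
      have e' : (fun ω => P (schemeEnd Φ x T (n₀ * M ^ (l - 1)) 0 fun t => W₀ t ω)) =
          fun ω => P (schemeEnd Φ x T (n₀ * M ^ (l - 1)) 0
            (stepPath T (n₀ * M ^ (l - 1)) (pathIncrements T (n₀ * M ^ (l - 1))
              fun t => W₀ t ω))) := by
        ext ω
        rw [schemeEnd_eq_stepPath Φ x hT hn le_rfl (mul_one _).symm, driftShift_zero]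
      rw [e']
      exact hP.comp ((measurable_schemePath_stepPath hΦ x T _ _ _).comp hZ)
    exact hs.sub (hP.comp hX)
  have hM1 : (1 : ℝ) ≤ M := by exact_mod_cast hM
  have hpow : ((T : ℝ) / n₀ / (M ^ (l - 1) : ℕ)) ^ (β * r / 2) ≤
      ((T : ℝ) / n₀ / (M : ℝ) ^ (l - 2)) ^ (β * r / 2) := by
    push_cast
    gcongr
    norm_num
  calc _ ≤ ∫⁻ ω, ENNReal.ofReal (2 ^ r) * (ENNReal.ofReal
        (|P (schemeEnd Φ x T (n₀ * M ^ (l - 1)) 0 fun t => W₀ t ω) - P (X T ω)| ^ r) +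
        ENNReal.ofReal
        (|P (schemeEnd Φ x T (n₀ * M ^ (l - 2)) 0 fun t => W₀ t ω) - P (X T ω)| ^ r)) ∂μ₀ := by
        refine lintegral_mono fun ω => ?_
        rw [← ENNReal.ofReal_add (by positivity) (by positivity),
          ← ENNReal.ofReal_mul (by positivity)]
        exact ENNReal.ofReal_le_ofReal (abs_sub_rpow_le hr.le _ _ _)
    _ = ENNReal.ofReal (2 ^ r) * (∫⁻ ω, ENNReal.ofReal
        (|P (schemeEnd Φ x T (n₀ * M ^ (l - 1)) 0 fun t => W₀ t ω) - P (X T ω)| ^ r) ∂μ₀ +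
        ∫⁻ ω, ENNReal.ofReal
        (|P (schemeEnd Φ x T (n₀ * M ^ (l - 2)) 0 fun t => W₀ t ω) - P (X T ω)| ^ r) ∂μ₀) := by
        rw [lintegral_const_mul' _ _ ENNReal.ofReal_ne_top, lintegral_add_left (by fun_prop)]
    _ ≤ ENNReal.ofReal (2 ^ r) * (ENNReal.ofReal
        (V * ((T : ℝ) / n₀ / (M : ℝ) ^ (l - 2)) ^ (β * r / 2)) + ENNReal.ofReal
        (V * ((T : ℝ) / n₀ / (M : ℝ) ^ (l - 2)) ^ (β * r / 2))) := by
        gcongr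
        · exact h1.trans (ENNReal.ofReal_le_ofReal (by gcongr))
        · exact h2.trans (ENNReal.ofReal_le_ofReal (by push_cast; rfl))
    _ = _ := by
        rw [← ENNReal.ofReal_add (by positivity) (by positivity),
          ← ENNReal.ofReal_mul (by positivity), Real.rpow_add_one (by norm_num)]
        congr 1
        ring

/-- The constant in the `p`-th moment bound of the weighted differences. -/
noncomputable def diffMomentConst (T p r c V : ℝ) : ℝ :=
  (2 ^ (r + 1) * V) ^ (p / r) *
    Real.exp ((((p - 1) * r / (r - p)) ^ 2 + (p - 1) * r / (r - p)) * c ^ 2 * T / 2) ^ (1 - p / r)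

theorem diffMomentConst_pos {T p r c V : ℝ} (hV : 0 < V) : 0 < diffMomentConst T p r c V := by
  unfold diffMomentConst
  positivity

/-- Two facts make the constant the same on all levels. The exponential factor depends on the grid
only through `n * (T / n) = T`, and the Hölder power `p / r` turns the rate `β r / 2` into exactly
`β p / 2`. -/
theorem lintegral_weightedDiff_rpow_le {Φ : ℝ → Vec d → Vec q → Vec d}
    (hΦ : ∀ h, Measurable fun z : Vec d × Vec q => Φ h z.1 z.2) (x : Vec d) {T : ℝ≥0}
    (hT : 0 < T) {n₀ M : ℕ} (hn₀ : 1 ≤ n₀) (hM : 1 ≤ M) {P : Vec d → ℝ} (hP : Measurable P)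
    {W₀ : ℝ≥0 → Ω₀ → Vec q} (hW : IsBrownianMotion W₀ μ₀) {X : ℝ≥0 → Ω₀ → Vec d}
    (hX : Measurable (X T)) {p r β V c : ℝ} (hp : 1 ≤ p) (hr : p < r) (hβ : 0 < β) (hV : 0 < V)
    (hS : StrongError μ₀ Φ x T n₀ P W₀ X r β V) {l : ℕ} (hl : 2 ≤ l) {θ : Vec q}
    (hθ : ‖θ‖ ≤ c) :
    ∫⁻ z, ENNReal.ofReal (|weightedDiff Φ x T P (n₀ * M ^ (l - 1)) (n₀ * M ^ (l - 2)) θ z| ^ p)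
        ∂incrementLaw q (n₀ * M ^ (l - 1)) (T / (n₀ * M ^ (l - 1) : ℕ)) ≤
      ENNReal.ofReal (diffMomentConst T p r c V *
        ((T : ℝ) / n₀ / (M : ℝ) ^ (l - 2)) ^ (β * p / 2)) := by
  have hr0 : 0 < r := by linarith
  have hn : 1 ≤ n₀ * M ^ (l - 1) := Nat.mul_pos hn₀ (Nat.pow_pos hM)
  have hn' : ((n₀ * M ^ (l - 1) : ℕ) : ℝ≥0) ≠ 0 := by exact_mod_cast (by omega)
  have hw : 0 ≤ 1 - p / r := by rw [sub_nonneg, div_le_one hr0]; exact hr.le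
  refine (lintegral_driftShift_mul_rpow_le (div_ne_zero hT.ne' hn') hp hr hθ
    (measurable_payoffDiff hΦ x T hP _ _)).trans ?_
  have h := lintegral_payoffDiff_rpow_le hΦ x hT hn₀ hM hP hW hX hr0 hβ hV hS hl
  have eT : ((n₀ * M ^ (l - 1) : ℕ) : ℝ) * ((T / (n₀ * M ^ (l - 1) : ℕ) : ℝ≥0) : ℝ) = T := by
    have : ((n₀ * M ^ (l - 1) : ℕ) : ℝ) ≠ 0 := by exact_mod_cast (by omega)
    rw [NNReal.coe_div, NNReal.coe_natCast, mul_div_cancel₀ _ this]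
  rw [eT]
  calc _ ≤ ENNReal.ofReal (2 ^ (r + 1) * V *
        ((T : ℝ) / n₀ / (M : ℝ) ^ (l - 2)) ^ (β * r / 2)) ^ (p / r) *
        ENNReal.ofReal (Real.exp ((((p - 1) * r / (r - p)) ^ 2 + (p - 1) * r / (r - p)) *
          c ^ 2 * T / 2)) ^ (1 - p / r) := by gcongr
    _ = _ := by
        have hp0 : 0 ≤ p / r := by positivity
        rw [ENNReal.ofReal_rpow_of_nonneg (by positivity) hp0,
          ENNReal.ofReal_rpow_of_nonneg (by positivity) hw, ← ENNReal.ofReal_mul (by positivity),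
          Real.mul_rpow (by positivity) (by positivity), ← Real.rpow_mul (by positivity),
          show β * r / 2 * (p / r) = β * p / 2 by field_simp, diffMomentConst]
        congr 1
        ring

/-- Jensen's inequality, obtained from Hölder against the constant 1; in extended nonnegative form
it requires no integrability. -/
theorem ofReal_abs_integral_rpow_le {E : Type*} [MeasurableSpace E] (ν : Measure E)
    [IsProbabilityMeasure ν] {f : E → ℝ} (hf : Measurable f) {p : ℝ} (hp : 1 ≤ p) :
    ENNReal.ofReal (|∫ z, f z ∂ν| ^ p) ≤ ∫⁻ z, ENNReal.ofReal (|f z| ^ p) ∂ν := by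
  have hp0 : 0 < p := by linarith
  have h := ENNReal.lintegral_mul_norm_pow_le (μ := ν)
    (f := fun z => ENNReal.ofReal (|f z| ^ p)) (g := fun _ => 1) (by fun_prop) (by fun_prop)
    (p := 1 / p) (q := 1 - 1 / p) (by positivity)
    (by rw [sub_nonneg, div_le_one hp0]; exact hp) (by ring)
  have e : ∀ z, ENNReal.ofReal (|f z| ^ p) ^ (1 / p) = ‖f z‖ₑ := by
    intro z
    rw [ENNReal.ofReal_rpow_of_nonneg (by positivity) (by positivity),
      ← Real.rpow_mul (abs_nonneg _), mul_one_div_cancel hp0.ne', Real.rpow_one,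
      Real.enorm_eq_ofReal_abs]
  simp only [e, ENNReal.one_rpow, mul_one, lintegral_one, measure_univ] at h
  have h2 := (enorm_integral_le_lintegral_enorm (μ := ν) f).trans h
  rw [Real.enorm_eq_ofReal_abs] at h2
  calc ENNReal.ofReal (|∫ z, f z ∂ν| ^ p) = ENNReal.ofReal |∫ z, f z ∂ν| ^ p :=
        (ENNReal.ofReal_rpow_of_nonneg (abs_nonneg _) hp0.le).symm
    _ ≤ ((∫⁻ z, ENNReal.ofReal (|f z| ^ p) ∂ν) ^ (1 / p)) ^ p := by gcongr
    _ = _ := by rw [← ENNReal.rpow_mul, one_div_mul_cancel hp0.ne', ENNReal.rpow_one]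

theorem lintegral_abs_sub_integral_rpow_le {E : Type*} [MeasurableSpace E] {ν : Measure E}
    [IsProbabilityMeasure ν] {f : E → ℝ} (hf : Measurable f) {p B : ℝ} (hp : 1 ≤ p) (hB : 0 ≤ B)
    (h : ∫⁻ z, ENNReal.ofReal (|f z| ^ p) ∂ν ≤ ENNReal.ofReal B) :
    ∫⁻ z, ENNReal.ofReal (|f z - ∫ y, f y ∂ν| ^ p) ∂ν ≤ ENNReal.ofReal (2 ^ (p + 1) * B) := by
  have h2 := (ofReal_abs_integral_rpow_le ν hf hp).trans h
  set a := ∫ y, f y ∂ν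
  calc _ ≤ ∫⁻ z, ENNReal.ofReal (2 ^ p) * (ENNReal.ofReal (|f z| ^ p) +
          ENNReal.ofReal (|a| ^ p)) ∂ν := by
        refine lintegral_mono fun z => ?_
        rw [← ENNReal.ofReal_add (by positivity) (by positivity),
          ← ENNReal.ofReal_mul (by positivity)]
        refine ENNReal.ofReal_le_ofReal ?_
        simpa using abs_sub_rpow_le (by linarith : 0 ≤ p) (f z) a 0
    _ ≤ ENNReal.ofReal (2 ^ p) * (ENNReal.ofReal B + ENNReal.ofReal B) := by
        rw [lintegral_const_mul' _ _ ENNReal.ofReal_ne_top, lintegral_add_right _ measurable_const,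
          lintegral_const, measure_univ, mul_one]
        gcongr
    _ = _ := by
        rw [← ENNReal.ofReal_add hB hB, ← ENNReal.ofReal_mul (by positivity),
          Real.rpow_add_one (by norm_num)]
        congr 1
        ring

/-- The change of measure removes `θ`: the weighted difference has the mean of the undrifted one,
which is why an adaptive choice of `θ` introduces no bias. -/
theorem levelMean_eq_integral_weightedDiff {Φ : ℝ → Vec d → Vec q → Vec d}
    (hΦ : ∀ h, Measurable fun z : Vec d × Vec q => Φ h z.1 z.2) (x : Vec d) {T : ℝ≥0}
    (hT : 0 < T) {n₀ M : ℕ} (hn₀ : 1 ≤ n₀) (hM : 1 ≤ M) {P : Vec d → ℝ} (hP : Measurable P)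
    {W₀ : ℝ≥0 → Ω₀ → Vec q} (hW : IsBrownianMotion W₀ μ₀) {l : ℕ} (hl : 2 ≤ l) (θ : Vec q) :
    levelMean μ₀ Φ x T n₀ M P W₀ l =
      ∫ z, weightedDiff Φ x T P (n₀ * M ^ (l - 1)) (n₀ * M ^ (l - 2)) θ z
        ∂incrementLaw q (n₀ * M ^ (l - 1)) (T / (n₀ * M ^ (l - 1) : ℕ)) := by
  have hn : 1 ≤ n₀ * M ^ (l - 1) := Nat.mul_pos hn₀ (Nat.pow_pos hM)
  have hm : 1 ≤ n₀ * M ^ (l - 2) := Nat.mul_pos hn₀ (Nat.pow_pos hM)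
  have hn' : ((n₀ * M ^ (l - 1) : ℕ) : ℝ≥0) ≠ 0 := by exact_mod_cast (by omega)
  have e : n₀ * M ^ (l - 1) = n₀ * M ^ (l - 2) * M := by
    rw [mul_assoc, ← pow_succ]
    congr 2
    omega
  have hPD := measurable_payoffDiff hΦ x T hP (n₀ * M ^ (l - 1)) (n₀ * M ^ (l - 2))
  have hZ : Measurable fun ω => pathIncrements T (n₀ * M ^ (l - 1)) fun t => W₀ t ω :=
    (measurable_pathIncrements T _).comp (measurable_pi_lambda _ hW.measurable)
  unfold weightedDiff
  rw [integral_driftShift_mul (div_ne_zero hT.ne' hn') θ hPD,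
    ← map_pathIncrements hW T (n₀ * M ^ (l - 1)),
    integral_map hZ.aemeasurable hPD.aestronglyMeasurable, levelMean]
  congr 1
  ext ω
  rw [← payoffDiff_driftShift Φ x hT P hm hM e 0, driftShift_zero]

theorem lintegral_weightedDiff_sub_levelMean_rpow_le {Φ : ℝ → Vec d → Vec q → Vec d}
    (hΦ : ∀ h, Measurable fun z : Vec d × Vec q => Φ h z.1 z.2) (x : Vec d) {T : ℝ≥0}
    (hT : 0 < T) {n₀ M : ℕ} (hn₀ : 1 ≤ n₀) (hM : 1 ≤ M) {P : Vec d → ℝ} (hP : Measurable P)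
    {W₀ : ℝ≥0 → Ω₀ → Vec q} (hW : IsBrownianMotion W₀ μ₀) {X : ℝ≥0 → Ω₀ → Vec d}
    (hX : Measurable (X T)) {p r β V c : ℝ} (hp : 1 ≤ p) (hr : p < r) (hβ : 0 < β) (hV : 0 < V)
    (hS : StrongError μ₀ Φ x T n₀ P W₀ X r β V) {l : ℕ} (hl : 2 ≤ l) {θ : Vec q}
    (hθ : ‖θ‖ ≤ c) :
    ∫⁻ z, ENNReal.ofReal (|weightedDiff Φ x T P (n₀ * M ^ (l - 1)) (n₀ * M ^ (l - 2)) θ z -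
          levelMean μ₀ Φ x T n₀ M P W₀ l| ^ p)
        ∂incrementLaw q (n₀ * M ^ (l - 1)) (T / (n₀ * M ^ (l - 1) : ℕ)) ≤
      ENNReal.ofReal (2 ^ (p + 1) * diffMomentConst T p r c V *
        ((T : ℝ) / n₀ / (M : ℝ) ^ (l - 2)) ^ (β * p / 2)) := by
  have hm := measurable_weightedDiff_right hΦ x T hP (n₀ * M ^ (l - 1)) (n₀ * M ^ (l - 2)) θ
  have hK := diffMomentConst_pos (T := T) (p := p) (r := r) (c := c) hV
  have h := lintegral_abs_sub_integral_rpow_le hm hp (by positivity)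
    (lintegral_weightedDiff_rpow_le hΦ x hT hn₀ hM hP hW hX hp hr hβ hV hS hl hθ)
  rw [← levelMean_eq_integral_weightedDiff hΦ x hT hn₀ hM hP hW hl θ] at h
  rwa [mul_assoc]

end LevelMoments

/-! ### Allocation of the samples -/

namespace ML2RParams

variable (π : ML2RParams)

theorem one_le_cUp_mul_cLow : 1 ≤ π.cUp * π.cLow := by
  have h : 0 < Real.sqrt (1 + (π.M : ℝ)⁻¹) := Real.sqrt_pos.2 (by positivity)
  have e : π.cUp * π.cLow = (1 + (π.M : ℝ) ^ (π.β / 2)) ^ 2 := by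
    unfold cUp cLow
    field_simp
  have h2 : 0 ≤ (π.M : ℝ) ^ (π.β / 2) := by positivity
  rw [e]
  nlinarith

theorem preAlloc_nonneg (hh : 0 < π.h) (L l : ℕ) : 0 ≤ π.preAlloc L l := by
  unfold preAlloc lam cLow
  split_ifs <;> positivity

theorem qStar_pos (hh : 0 < π.h) {L : ℕ} (hL : 1 ≤ L) : 0 < π.qStar L := by
  refine inv_pos.2 (Finset.sum_pos' (fun l _ => π.preAlloc_nonneg hh L l)
    ⟨1, Finset.mem_Icc.2 ⟨le_rfl, hL⟩, ?_⟩)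
  have : 0 ≤ π.lam * π.h ^ (π.β / 2) := by unfold lam; positivity
  simp only [preAlloc, if_true]
  linarith

/-- In the product of `size` and `alloc` the normalization `qStar` cancels and `lam ^ 2 * var = V₁`.
Only the part of `size` that contains the sum over levels is kept; the prefactor and `cUp * cLow`
are at least 1, and the ceiling only helps. -/
theorem le_levelSize (hα : 0 < π.α) (hh : 0 < π.h) (hV : 0 < π.V₁) (hvar : 0 < π.var)
    {ε : ℝ} (hε : 0 < ε) {L l : ℕ} (hl : l ∈ Finset.Icc 2 L) :
    π.V₁ * π.h ^ π.β * (∑ l ∈ Finset.Icc 2 L, |weight π.M π.α L l| *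
      (π.M : ℝ) ^ ((1 - π.β) / 2 * ((l : ℝ) - 1))) * (|weight π.M π.α L l| *
      (π.M : ℝ) ^ (-((1 + π.β) / 2) * ((l : ℝ) - 1))) / ε ^ 2 ≤ π.levelSize ε L l := by
  have hl' := Finset.mem_Icc.1 hl
  have hq := π.qStar_pos hh (L := L) (by omega)
  refine le_trans ?_ (Nat.le_ceil _)
  set S := ∑ l ∈ Finset.Icc 2 L, |weight π.M π.α L l| *
      (π.M : ℝ) ^ ((1 - π.β) / 2 * ((l : ℝ) - 1)) with hS
  have hS0 : 0 ≤ S := Finset.sum_nonneg fun l _ => by positivity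
  set A := |weight π.M π.α L l| * (π.M : ℝ) ^ (-((1 + π.β) / 2) * ((l : ℝ) - 1)) with hA
  have hA0 : 0 ≤ A := by positivity
  have hl1 : l ≠ 1 := by omega
  have hlam : π.lam ^ 2 * π.var = π.V₁ := by
    unfold lam
    rw [Real.sq_sqrt (by positivity)]
    field_simp
  have hlam0 : 0 ≤ π.lam := Real.sqrt_nonneg _
  have hcUp : 0 ≤ π.cUp := by unfold cUp; positivity
  have hcLow : 0 ≤ π.cLow := by unfold cLow; positivity
  have hH : (π.h ^ (π.β / 2)) ^ 2 = π.h ^ π.β := by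
    rw [← Real.rpow_natCast, ← Real.rpow_mul hh.le]
    congr 1
    push_cast
    ring
  set H := π.h ^ (π.β / 2) with hHdef
  have hH0 : 0 ≤ H := by positivity
  have e : π.size ε L * π.alloc L l =
      (1 + 1 / (2 * π.α * L)) * (π.var * (1 + π.lam * H + π.lam * H * π.cUp * S)) / ε ^ 2 *
        (π.lam * H * π.cLow * A) := by
    simp only [size, alloc, preAlloc, if_neg hl1]
    rw [← hS, hA, ← hHdef]
    field_simp
  have hB : π.var * (π.lam * H * π.cUp * S) ≤
      (1 + 1 / (2 * π.α * L)) * (π.var * (1 + π.lam * H + π.lam * H * π.cUp * S)) := by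
    have h1 : 1 ≤ 1 + 1 / (2 * π.α * (L : ℝ)) := by
      have : 0 ≤ 1 / (2 * π.α * (L : ℝ)) := by positivity
      linarith
    have h2 : π.var * (π.lam * H * π.cUp * S) ≤
        π.var * (1 + π.lam * H + π.lam * H * π.cUp * S) := by
      gcongr
      have : 0 ≤ π.lam * H := by positivity
      linarith
    calc _ ≤ _ := h2
      _ ≤ _ := le_mul_of_one_le_left (by positivity) h1
  rw [e]
  calc π.V₁ * π.h ^ π.β * S * A / ε ^ 2
      = π.lam ^ 2 * π.var * H ^ 2 * S * A / ε ^ 2 * 1 := by rw [hlam, hH, mul_one]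
    _ ≤ π.lam ^ 2 * π.var * H ^ 2 * S * A / ε ^ 2 * (π.cUp * π.cLow) := by
        gcongr
        exact π.one_le_cUp_mul_cLow
    _ = π.var * (π.lam * H * π.cUp * S) / ε ^ 2 * (π.lam * H * π.cLow * A) := by ring
    _ ≤ _ := by gcongr

/-- The allocation keeps the variance proxy `∑ W̃_l² h_l^β / N_l` of the correction levels of
order `ε²`. -/
theorem sum_sq_weight_div_levelSize_le (hM : 1 ≤ π.M) (hα : 0 < π.α) (hh : 0 < π.h)
    (hV : 0 < π.V₁) (hvar : 0 < π.var) {ε : ℝ} (hε : 0 < ε) (L : ℕ) :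
    ∑ l ∈ Finset.Icc 2 L, weight π.M π.α L l ^ 2 / π.levelSize ε L l *
      (π.h ^ π.β * (π.M : ℝ) ^ (-π.β * ((l : ℝ) - 1))) ≤ ε ^ 2 / π.V₁ := by
  set S := ∑ l ∈ Finset.Icc 2 L, |weight π.M π.α L l| *
      (π.M : ℝ) ^ ((1 - π.β) / 2 * ((l : ℝ) - 1)) with hS
  have hM0 : (0 : ℝ) < π.M := by exact_mod_cast hM
  have hS0 : 0 ≤ S := Finset.sum_nonneg fun l _ => by positivity
  -- Since `-β = (1 - β) / 2 - (1 + β) / 2`, the lower bound on `N_l` cancels one weight and one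
  -- power of `M`. Each level is left with its share of `S`, and the shares add up to `ε² / V₁`.
  have hterm : ∀ l ∈ Finset.Icc 2 L, weight π.M π.α L l ^ 2 / π.levelSize ε L l *
      (π.h ^ π.β * (π.M : ℝ) ^ (-π.β * ((l : ℝ) - 1))) ≤
      ε ^ 2 / (π.V₁ * S) * (|weight π.M π.α L l| *
        (π.M : ℝ) ^ ((1 - π.β) / 2 * ((l : ℝ) - 1))) := by
    intro l hl
    rcases eq_or_ne (weight π.M π.α L l) 0 with hw | hw
    · simp [hw]
    have hw' : 0 < |weight π.M π.α L l| := abs_pos.2 hw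
    have hSpos : 0 < S := Finset.sum_pos' (fun l _ => by positivity) ⟨l, hl, by positivity⟩
    have hN := π.le_levelSize hα hh hV hvar hε hl
    rw [← hS] at hN
    set w := weight π.M π.α L l
    set A := (π.M : ℝ) ^ (-((1 + π.β) / 2) * ((l : ℝ) - 1)) with hA
    have hA0 : 0 < A := by positivity
    have hb0 : 0 < π.h ^ π.β := by positivity
    have hM1 : (π.M : ℝ) ^ (-π.β * ((l : ℝ) - 1)) =
        (π.M : ℝ) ^ ((1 - π.β) / 2 * ((l : ℝ) - 1)) * A := by
      rw [hA, ← Real.rpow_add hM0]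
      congr 1
      ring
    calc w ^ 2 / π.levelSize ε L l * (π.h ^ π.β * (π.M : ℝ) ^ (-π.β * ((l : ℝ) - 1)))
        ≤ w ^ 2 / (π.V₁ * π.h ^ π.β * S * (|w| * A) / ε ^ 2) *
          (π.h ^ π.β * (π.M : ℝ) ^ (-π.β * ((l : ℝ) - 1))) := by gcongr
      _ = _ := by
        rw [hM1, ← sq_abs w]
        field_simp
  refine (Finset.sum_le_sum hterm).trans ?_
  rw [← Finset.mul_sum, ← hS]
  -- When `S = 0` all the weights vanish, or there is no level, and the bound is trivial.
  rcases hS0.eq_or_lt with h | h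
  · rw [← h]
    simp only [mul_zero]
    positivity
  · exact le_of_eq (by field_simp)

end ML2RParams

/-! ### Functions of independent variables -/

section Independence

variable {Ω E F : Type*} [MeasurableSpace Ω] [MeasurableSpace E] [MeasurableSpace F]
  {μ : Measure Ω} [IsProbabilityMeasure μ] {A : Ω → E} {Z : Ω → F}

/-- Fubini under the product law replaces conditioning on `A`. The bound is asked only at values
that `A` takes, because the parameters are controlled only on `Θ`. -/
theorem lintegral_comp_indepFun_le (hA : Measurable A) (hZ : Measurable Z)
    (hAZ : IndepFun A Z μ) {f : E × F → ℝ≥0∞} (hf : Measurable f) {b : ℝ≥0∞}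
    (h : ∀ ω, ∫⁻ z, f (A ω, z) ∂μ.map Z ≤ b) : ∫⁻ ω, f (A ω, Z ω) ∂μ ≤ b := by
  have := Measure.isProbabilityMeasure_map (μ := μ) hA.aemeasurable
  have := Measure.isProbabilityMeasure_map (μ := μ) hZ.aemeasurable
  have e := hAZ.map_prod_eq_prod_map_map hA.aemeasurable hZ.aemeasurable
  calc ∫⁻ ω, f (A ω, Z ω) ∂μ = ∫⁻ y, f y ∂μ.map (fun ω => (A ω, Z ω)) :=
        (lintegral_map hf (hA.prodMk hZ)).symm
    _ = ∫⁻ ω, ∫⁻ z, f (A ω, z) ∂μ.map Z ∂μ := by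
        rw [e, lintegral_prod _ hf.aemeasurable, lintegral_map hf.lintegral_prod_right' hA]
    _ ≤ ∫⁻ _, b ∂μ := lintegral_mono h
    _ = b := by simp

theorem integral_comp_indepFun_eq_zero (hA : Measurable A) (hZ : Measurable Z)
    (hAZ : IndepFun A Z μ) {f : E × F → ℝ} (hf : Measurable f)
    (hi : Integrable (fun ω => f (A ω, Z ω)) μ)
    (h : ∀ ω, ∫ z, f (A ω, z) ∂μ.map Z = 0) : ∫ ω, f (A ω, Z ω) ∂μ = 0 := by
  have := Measure.isProbabilityMeasure_map (μ := μ) hA.aemeasurable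
  have := Measure.isProbabilityMeasure_map (μ := μ) hZ.aemeasurable
  have e := hAZ.map_prod_eq_prod_map_map hA.aemeasurable hZ.aemeasurable
  have hi' : Integrable f ((μ.map A).prod (μ.map Z)) := by
    rw [← e]
    exact (integrable_map_measure hf.aestronglyMeasurable (hA.prodMk hZ).aemeasurable).2 hi
  calc ∫ ω, f (A ω, Z ω) ∂μ = ∫ y, f y ∂μ.map (fun ω => (A ω, Z ω)) :=
        (integral_map (hA.prodMk hZ).aemeasurable hf.aestronglyMeasurable).symm
    _ = ∫ ω, ∫ z, f (A ω, z) ∂μ.map Z ∂μ := by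
        rw [e, integral_prod _ hi', integral_map hA.aemeasurable
          hf.stronglyMeasurable.integral_prod_right'.aestronglyMeasurable]
    _ = 0 := by simp [h]

end Independence

/-! ### Adaptive sums over independent paths -/

section AdaptiveSum

variable {Ω : Type*} {q : ℕ} {W : ℕ → ℕ → ℝ≥0 → Ω → Vec q}

/-- The σ-algebra generated by the sample path `i = (l, k)`. -/
abbrev pathAlgebra (W : ℕ → ℕ → ℝ≥0 → Ω → Vec q) (i : ℕ × ℕ) : MeasurableSpace Ω :=
  MeasurableSpace.comap (fun ω t => W i.1 i.2 t ω) MeasurableSpace.pi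

/-- The σ-algebra generated by all sample paths but the path `i = (l, k)`. -/
abbrev otherPathsAlgebra (W : ℕ → ℕ → ℝ≥0 → Ω → Vec q) (i : ℕ × ℕ) : MeasurableSpace Ω :=
  ⨆ j ∈ ({i}ᶜ : Set (ℕ × ℕ)), pathAlgebra W j

theorem pathAlgebra_le_otherPathsAlgebra {i j : ℕ × ℕ} (h : j ≠ i) :
    pathAlgebra W j ≤ otherPathsAlgebra W i :=
  le_iSup₂_of_le j h le_rfl

theorem sampleHistory_le_otherPathsAlgebra (T : ℝ≥0) {k' k : ℕ} (h : k' < k) (l : ℕ) :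
    sampleHistory W T k' ≤ otherPathsAlgebra W (l, k) := by
  refine iSup_le fun l' => iSup₂_le fun j hj => iSup₂_le fun t _ => ?_
  have hj' := (Finset.mem_Icc.1 hj).2
  refine le_trans ?_ (pathAlgebra_le_otherPathsAlgebra (j := (l', j)) ?_)
  · rw [← measurable_iff_comap_le]
    exact (measurable_pi_apply t).comp (comap_measurable fun ω t => W l' j t ω)
  · rintro h'
    simp only [Prod.mk.injEq] at h'
    omega

variable [mΩ : MeasurableSpace Ω] {μ : Measure Ω}

theorem pathAlgebra_le (hW : ∀ l k t, Measurable (W l k t)) (i : ℕ × ℕ) : pathAlgebra W i ≤ mΩ :=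
  (measurable_pi_lambda _ (hW i.1 i.2)).comap_le

theorem otherPathsAlgebra_le (hW : ∀ l k t, Measurable (W l k t)) (i : ℕ × ℕ) :
    otherPathsAlgebra W i ≤ mΩ :=
  iSup₂_le fun j _ => pathAlgebra_le hW j

/-- This takes the place of a filtration: the current parameter and all earlier summands are
measurable with respect to the paths other than `i`, so they can be frozen together. -/
theorem indep_otherPathsAlgebra (hW : ∀ l k t, Measurable (W l k t))
    (hind : iIndepFun (fun (i : ℕ × ℕ) (ω : Ω) (t : ℝ≥0) => W i.1 i.2 t ω) μ) (i : ℕ × ℕ) :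
    Indep (otherPathsAlgebra W i) (pathAlgebra W i) μ := by
  have h := indep_iSup_of_disjoint (m := pathAlgebra W) (fun j => pathAlgebra_le hW j)
    ((iIndepFun_iff_iIndep _ _ _).1 hind) (S := {i}ᶜ) (T := {i}) disjoint_compl_left
  simpa only [iSup_singleton] using h

theorem indepFun_path_of_measurable_otherPathsAlgebra (hW : ∀ l k t, Measurable (W l k t))
    (hind : iIndepFun (fun (i : ℕ × ℕ) (ω : Ω) (t : ℝ≥0) => W i.1 i.2 t ω) μ) {l k : ℕ}
    {E : Type*} [MeasurableSpace E] {A : Ω → E} (hA : Measurable[otherPathsAlgebra W (l, k)] A) :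
    IndepFun A (fun ω t => W l k t ω) μ :=
  indep_of_indep_of_le_left (indep_otherPathsAlgebra hW hind (l, k)) hA.comap_le

/-- Moment bound for a sum of centred functions of independent paths, whose parameters are
chosen from the preceding samples. The index `toLex (k, l)` stands for sample `k` of level `l`. -/
theorem integral_abs_adaptive_sum_rpow_le [IsProbabilityMeasure μ] {p : ℝ} (hp : 2 ≤ p) {C : ℝ} (hC1 : 1 ≤ C)
    (hC : ∀ x y : ℝ, |x + y| ^ p ≤ |x| ^ p + p * (|x| ^ (p - 2) * x * y)
        + C * (|x| ^ (p - 2) * y ^ 2 + |y| ^ p))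
    (hW : ∀ l k t, Measurable (W l k t))
    (hind : iIndepFun (fun (i : ℕ × ℕ) (ω : Ω) (t : ℝ≥0) => W i.1 i.2 t ω) μ)
    {T : ℝ≥0} {θ : ℕ → ℕ → Ω → Vec q} {Θ : Set (Vec q)}
    (hθ : ∀ l k, 2 ≤ l → Measurable[sampleHistory W T k] (θ l k))
    (hΘ : ∀ l k, 2 ≤ l → ∀ ω, θ l k ω ∈ Θ)
    {F : ℕ → Vec q × (ℝ≥0 → Vec q) → ℝ} (hF : ∀ l, Measurable (F l)) {b : ℕ → ℝ}
    (hb : ∀ l, 0 ≤ b l)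
    (hF0 : ∀ l k, 2 ≤ l → ∀ ϑ ∈ Θ, ∫ ω, F l (ϑ, fun t => W l k t ω) ∂μ = 0)
    (hFb : ∀ l k, 2 ≤ l → ∀ ϑ ∈ Θ,
      ∫⁻ ω, ENNReal.ofReal (|F l (ϑ, fun t => W l k t ω)| ^ p) ∂μ ≤ ENNReal.ofReal (b l ^ (p / 2)))
    (s : Finset (ℕ ×ₗ ℕ)) (hs : ∀ i ∈ s, 1 ≤ (ofLex i).1 ∧ 2 ≤ (ofLex i).2) :
    Integrable (fun ω => |∑ i ∈ s, F (ofLex i).2 (θ (ofLex i).2 ((ofLex i).1 - 1) ω,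
        fun t => W (ofLex i).2 (ofLex i).1 t ω)| ^ p) μ ∧
    ∫ ω, |∑ i ∈ s, F (ofLex i).2 (θ (ofLex i).2 ((ofLex i).1 - 1) ω,
        fun t => W (ofLex i).2 (ofLex i).1 t ω)| ^ p ∂μ ≤
      (2 * C * ∑ i ∈ s, b (ofLex i).2) ^ (p / 2) := by
  have hp0 : 0 < p := by linarith
  set D : ℕ ×ₗ ℕ → Ω → ℝ := fun i ω => F (ofLex i).2 (θ (ofLex i).2 ((ofLex i).1 - 1) ω,
    fun t => W (ofLex i).2 (ofLex i).1 t ω)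
  have hpath : ∀ l k, Measurable fun ω t => W l k t ω :=
    fun l k => measurable_pi_lambda _ (hW l k)
  have hθo : ∀ i ∈ s, Measurable[otherPathsAlgebra W ((ofLex i).2, (ofLex i).1)]
      (θ (ofLex i).2 ((ofLex i).1 - 1)) := fun i hi =>
    (hθ _ _ (hs i hi).2).mono (sampleHistory_le_otherPathsAlgebra T
      (by have := (hs i hi).1; omega) _) le_rfl
  have hθm : ∀ i ∈ s, Measurable (θ (ofLex i).2 ((ofLex i).1 - 1)) := fun i hi =>
    (hθo i hi).mono (otherPathsAlgebra_le hW _) le_rfl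
  have hDm : ∀ i ∈ s, Measurable (D i) := fun i hi =>
    (hF _).comp ((hθm i hi).prodMk (hpath _ _))
  have hDlin : ∀ i ∈ s, ∫⁻ ω, ENNReal.ofReal (|D i ω| ^ p) ∂μ ≤
      ENNReal.ofReal (b (ofLex i).2 ^ (p / 2)) := by
    intro i hi
    have hFi := hF (ofLex i).2
    refine lintegral_comp_indepFun_le (hθm i hi) (hpath _ _) (indepFun_path_of_measurable_otherPathsAlgebra hW hind (hθo i hi))
      (f := fun y => ENNReal.ofReal (|F (ofLex i).2 y| ^ p)) (by fun_prop) fun ω => ?_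
    rw [lintegral_map (by fun_prop) (hpath _ _)]
    exact hFb _ _ (hs i hi).2 _ (hΘ _ _ (hs i hi).2 ω)
  have hDmem : ∀ i ∈ s, MemLp (D i) (ENNReal.ofReal p) μ := by
    intro i hi
    refine ⟨(hDm i hi).aestronglyMeasurable, ?_⟩
    rw [eLpNorm_lt_top_iff_lintegral_rpow_enorm_lt_top (by simpa using hp0) (by simp),
      ENNReal.toReal_ofReal hp0.le]
    refine lt_of_le_of_lt (le_of_eq ?_) ((hDlin i hi).trans_lt ENNReal.ofReal_lt_top)
    refine lintegral_congr fun ω => ?_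
    rw [Real.enorm_eq_ofReal_abs, ENNReal.ofReal_rpow_of_nonneg (abs_nonneg _) hp0.le]
  refine ⟨integrable_abs_rpow_of_memLp hp0 (memLp_finsetSum s hDmem), ?_⟩
  refine integral_abs_sum_rpow_le hp hC1 hC s hDmem (fun i _ => hb _) (fun i hi => ?_)
    fun i hi u hu hlt => ?_
  · rw [integral_eq_lintegral_of_nonneg_ae (.of_forall fun ω => by positivity)
      (integrable_abs_rpow_of_memLp hp0 (hDmem i hi)).1]
    exact ENNReal.toReal_le_of_le_ofReal (by have := hb (ofLex i).2; positivity) (hDlin i hi)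
  -- An earlier index has a smaller sample number, or the same one and a lower level. Either way its
  -- path differs from path `i`, and its parameter uses only smaller sample numbers. Ordering by
  -- level first would fail, since parameters of lower levels may depend on samples of higher ones.
  · have hSo : Measurable[otherPathsAlgebra W ((ofLex i).2, (ofLex i).1)]
        fun ω => ∑ j ∈ u, D j ω := by
      refine Finset.measurable_fun_sum _ fun j hj => ?_
      have hlt' := Prod.Lex.lt_iff.1 (hlt j hj)
      have hj1 := hs j (hu hj)
      refine (hF _).comp (Measurable.prodMk ?_ ?_)
      · refine (hθ _ _ hj1.2).mono (sampleHistory_le_otherPathsAlgebra T ?_ _) le_rfl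
        omega
      · refine Measurable.mono (comap_measurable _) (pathAlgebra_le_otherPathsAlgebra
          (j := ((ofLex j).2, (ofLex j).1)) ?_) le_rfl
        intro h
        simp only [Prod.mk.injEq] at h
        omega
    have hSm : Measurable fun ω => ∑ j ∈ u, D j ω :=
      hSo.mono (otherPathsAlgebra_le hW _) le_rfl
    have hFi := hF (ofLex i).2
    -- The partial sum and the parameter are frozen jointly; the power of the sum leaves the inner
    -- integral, and what is left is a centred term.
    refine integral_comp_indepFun_eq_zero (hSm.prodMk (hθm i hi)) (hpath _ _)
      (indepFun_path_of_measurable_otherPathsAlgebra hW hind (hSo.prodMk (hθo i hi)))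
      (f := fun y => |y.1.1| ^ (p - 2) * y.1.1 * F (ofLex i).2 (y.1.2, y.2)) (by fun_prop)
      (integrable_abs_rpow_mul_mul hp (memLp_finsetSum u fun j hj => hDmem j (hu hj))
        (hDmem i hi)) fun ω => ?_
    simp only
    rw [integral_const_mul, integral_map (hpath _ _).aemeasurable
      (Measurable.aestronglyMeasurable (by fun_prop)),
      hF0 _ _ (hs i hi).2 _ (hΘ _ _ (hs i hi).2 ω), mul_zero]

end AdaptiveSum


/-! ### Starting point of the paths and powers of the step sizes. -/

theorem IsBrownianMotion.ae_eval_zero {Ω : Type*} [MeasurableSpace Ω] {μ : Measure Ω} {q : ℕ}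
    {W : ℝ≥0 → Ω → Vec q} (hW : IsBrownianMotion W μ) : ∀ᵐ ω ∂μ, W 0 ω = 0 := by
  have h : ∀ᵐ ω ∂μ, ∀ j, W 0 ω j = 0 :=
    ae_all_iff.2 fun j => (hW.coord j).toIsPreBrownianReal.eval_zero_ae_eq_zero
  filter_upwards [h] with ω hω
  ext j
  exact hω j

/-- Moment bounds use the coarser step of level `l`, the allocation uses the finer one; the ratio
`M` of the two is the source of `M ^ β` in the final constant. -/
theorem rpow_step_eq {M l : ℕ} (hM : 1 ≤ M) (hl : 2 ≤ l) {h : ℝ} (hh : 0 < h) (β : ℝ) :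
    (h / (M : ℝ) ^ (l - 2)) ^ β = (M : ℝ) ^ β * (h ^ β * (M : ℝ) ^ (-β * ((l : ℝ) - 1))) := by
  have hM0 : (0 : ℝ) < M := by exact_mod_cast hM
  have e : (M : ℝ) ^ (l - 2) = (M : ℝ) ^ ((l : ℝ) - 2) := by
    rw [← Real.rpow_natCast, Nat.cast_sub hl]
    norm_num
  rw [e, Real.div_rpow hh.le (by positivity), ← Real.rpow_mul hM0.le, div_eq_mul_inv,
    ← Real.rpow_neg hM0.le, mul_left_comm, ← Real.rpow_add hM0]
  congr 2
  ring

/-! ### The correction part of the estimator -/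

section CorrectionPart

variable {d q : ℕ} {Ω₀ : Type*} [MeasurableSpace Ω₀] {μ₀ : Measure Ω₀} [IsProbabilityMeasure μ₀]

theorem integral_weightedDiff_sub_levelMean_eq_zero {Φ : ℝ → Vec d → Vec q → Vec d}
    (hΦ : ∀ h, Measurable fun z : Vec d × Vec q => Φ h z.1 z.2) (x : Vec d) {T : ℝ≥0}
    (hT : 0 < T) {n₀ M : ℕ} (hn₀ : 1 ≤ n₀) (hM : 1 ≤ M) {P : Vec d → ℝ} (hP : Measurable P)
    {W₀ : ℝ≥0 → Ω₀ → Vec q} (hW : IsBrownianMotion W₀ μ₀) {l : ℕ} (hl : 2 ≤ l) (θ : Vec q) :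
    ∫ z, (weightedDiff Φ x T P (n₀ * M ^ (l - 1)) (n₀ * M ^ (l - 2)) θ z -
        levelMean μ₀ Φ x T n₀ M P W₀ l)
      ∂incrementLaw q (n₀ * M ^ (l - 1)) (T / (n₀ * M ^ (l - 1) : ℕ)) = 0 := by
  rw [levelMean_eq_integral_weightedDiff hΦ x hT hn₀ hM hP hW hl θ]
  -- Subtracting the average centres any function under a finite measure, so integrability need not
  -- be checked.
  have h := integral_sub_average (incrementLaw q (n₀ * M ^ (l - 1)) (T / (n₀ * M ^ (l - 1) : ℕ)))
    (weightedDiff Φ x T P (n₀ * M ^ (l - 1)) (n₀ * M ^ (l - 2)) θ)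
  rwa [average_eq_integral] at h

theorem measurable_weightedDiff_pathIncrements {Φ : ℝ → Vec d → Vec q → Vec d}
    (hΦ : ∀ h, Measurable fun z : Vec d × Vec q => Φ h z.1 z.2) (x : Vec d) (T : ℝ≥0)
    {P : Vec d → ℝ} (hP : Measurable P) (n m : ℕ) :
    Measurable fun y : Vec q × (ℝ≥0 → Vec q) =>
      weightedDiff Φ x T P n m y.1 (pathIncrements T n y.2) := by
  have h : Measurable fun y : Vec q × (ℝ≥0 → Vec q) => (y.1, pathIncrements T n y.2) :=
    measurable_fst.prodMk ((measurable_pathIncrements T n).comp measurable_snd)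
  have h1 := (measurable_driftShift (n := n) (T / n)).comp h
  have h2 := (measurable_logDensity (n := n) (T / n)).comp h
  exact ((measurable_payoffDiff hΦ x T hP n m).comp h1).mul (Real.measurable_exp.comp h2)

theorem integral_abs_correctionPart_rpow_le (π : ML2RParams) (hM : 1 ≤ π.M) (hα : 0 < π.α)
    (hβ : 0 < π.β) (hV₁ : 0 < π.V₁) (hvar : 0 < π.var)
    {p : ℝ} (hp : 2 ≤ p) {C : ℝ} (hC1 : 1 ≤ C)
    (hC : ∀ x y : ℝ, |x + y| ^ p ≤ |x| ^ p + p * (|x| ^ (p - 2) * x * y)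
        + C * (|x| ^ (p - 2) * y ^ 2 + |y| ^ p))
    {T : ℝ≥0} (hT : 0 < T) {n₀ : ℕ} (hn₀ : 1 ≤ n₀) (hh : π.h = (T : ℝ) / n₀)
    {r V c : ℝ} (hr : p < r) (hV : 0 < V)
    {W₀ : ℝ≥0 → Ω₀ → Vec q} (hW₀ : IsBrownianMotion W₀ μ₀) {X : ℝ≥0 → Ω₀ → Vec d}
    (hX : Measurable (X T)) (x : Vec d) {P : Vec d → ℝ} (hP : Measurable P)
    {Φ : ℝ → Vec d → Vec q → Vec d}
    (hΦ : ∀ h, Measurable fun z : Vec d × Vec q => Φ h z.1 z.2)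
    (hS : StrongError μ₀ Φ x T n₀ P W₀ X r π.β V)
    {Ω : Type*} [MeasurableSpace Ω] {μ : Measure Ω} [IsProbabilityMeasure μ]
    {W : ℕ → ℕ → ℝ≥0 → Ω → Vec q} (hW : ∀ l k, IsBrownianMotion (W l k) μ)
    (hind : iIndepFun (fun (i : ℕ × ℕ) (ω : Ω) (t : ℝ≥0) => W i.1 i.2 t ω) μ)
    {Θ : Set (Vec q)} (hΘ : Θ ⊆ Metric.closedBall 0 c) {θ : ℕ → ℕ → Ω → Vec q}
    (hθ : ∀ l k, 2 ≤ l → Measurable[sampleHistory W T k] (θ l k))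
    (hθΘ : ∀ l k, 2 ≤ l → ∀ ω, θ l k ω ∈ Θ) {ε : ℝ} (hε : 0 < ε) :
    Integrable (fun ω => |correctionPart π ε Φ x T n₀ P
      (levelMean μ₀ Φ x T n₀ π.M P W₀) θ W ω| ^ p) μ ∧
    ∫ ω, |correctionPart π ε Φ x T n₀ P (levelMean μ₀ Φ x T n₀ π.M P W₀) θ W ω| ^ p ∂μ ≤
      (2 * C * ((2 ^ (p + 1) * diffMomentConst T p r c V) ^ (2 / p) *
        (π.M : ℝ) ^ π.β / π.V₁)) ^ (p / 2) * ε ^ p := by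
  have hp0 : 0 < p := by linarith
  have hM0 : (0 : ℝ) < π.M := by exact_mod_cast hM
  have hn₀' : (0 : ℝ) < n₀ := by exact_mod_cast hn₀
  have hT' : (0 : ℝ) < T := hT
  have hh0 : 0 < π.h := by rw [hh]; positivity
  have hK₁0 : 0 < 2 ^ (p + 1) * diffMomentConst T p r c V :=
    mul_pos (by positivity) (diffMomentConst_pos hV)
  have hparam := π.sum_sq_weight_div_levelSize_le hM hα hh0 hV₁ hvar hε (π.depth ε)
  have hcb := fun (l : ℕ) (hl : 2 ≤ l) (ϑ : Vec q) (hϑ : ϑ ∈ Θ) =>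
    lintegral_weightedDiff_sub_levelMean_rpow_le hΦ x hT hn₀ hM hP hW₀ hX
      (by linarith : 1 ≤ p) hr hβ hV hS hl (by simpa using hΘ hϑ : ‖ϑ‖ ≤ c)
  generalize 2 ^ (p + 1) * diffMomentConst T p r c V = K₁ at *
  set L := π.depth ε
  let N : ℕ → ℕ := fun l => π.levelSize ε L l
  let a : ℕ → ℝ := fun l => weight π.M π.α L l / (N l : ℝ)
  let m : ℕ → ℝ := levelMean μ₀ Φ x T n₀ π.M P W₀
  let F : ℕ → Vec q × (ℝ≥0 → Vec q) → ℝ := fun l y =>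
    a l * (weightedDiff Φ x T P (n₀ * π.M ^ (l - 1)) (n₀ * π.M ^ (l - 2)) y.1
      (pathIncrements T (n₀ * π.M ^ (l - 1)) y.2) - m l)
  -- A bound for the squared `L^p` norm of one summand, with the factor `W̃_l / N_l` included.
  let b : ℕ → ℝ := fun l => a l ^ 2 * (K₁ ^ (2 / p) * (π.h / (π.M : ℝ) ^ (l - 2)) ^ π.β)
  have hh' : ∀ l, (T : ℝ) / n₀ / (π.M : ℝ) ^ (l - 2) = π.h / (π.M : ℝ) ^ (l - 2) := by
    intro l; rw [hh]
  have hF : ∀ l, Measurable (F l) := fun l =>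
    ((measurable_weightedDiff_pathIncrements hΦ x T hP _ _).sub_const _).const_mul _
  have hb : ∀ l, 0 ≤ b l := fun l => by
    have : 0 ≤ π.h / (π.M : ℝ) ^ (l - 2) := by positivity
    positivity
  have hZ : ∀ l k n, Measurable fun ω => pathIncrements T n fun t => W l k t ω := fun l k n =>
    (measurable_pathIncrements T n).comp (measurable_pi_lambda _ (hW l k).measurable)
  have hG : ∀ l (ϑ : Vec q), Measurable
      (weightedDiff Φ x T P (n₀ * π.M ^ (l - 1)) (n₀ * π.M ^ (l - 2)) ϑ) := fun l ϑ =>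
    measurable_weightedDiff_right hΦ x T hP _ _ ϑ
  have hF0 : ∀ l k, 2 ≤ l → ∀ ϑ ∈ Θ, ∫ ω, F l (ϑ, fun t => W l k t ω) ∂μ = 0 := by
    intro l k hl ϑ _
    have h := integral_weightedDiff_sub_levelMean_eq_zero hΦ x hT hn₀ hM hP hW₀ hl ϑ
    rw [← map_pathIncrements (hW l k) T, integral_map (hZ l k _).aemeasurable
      ((hG l ϑ).sub_const _).aestronglyMeasurable] at h
    simp only [F, integral_const_mul]
    rw [h, mul_zero]
  have hFb : ∀ l k, 2 ≤ l → ∀ ϑ ∈ Θ,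
      ∫⁻ ω, ENNReal.ofReal (|F l (ϑ, fun t => W l k t ω)| ^ p) ∂μ ≤
        ENNReal.ofReal (b l ^ (p / 2)) := by
    intro l k hl ϑ hϑ
    have h := hcb l hl ϑ hϑ
    have hm := (hG l ϑ).sub_const (levelMean μ₀ Φ x T n₀ π.M P W₀ l)
    rw [← map_pathIncrements (hW l k) T, lintegral_map (by fun_prop) (hZ l k _), hh'] at h
    have e : ∀ ω, ENNReal.ofReal (|F l (ϑ, fun t => W l k t ω)| ^ p) =
        ENNReal.ofReal (|a l| ^ p) * ENNReal.ofReal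
          (|weightedDiff Φ x T P (n₀ * π.M ^ (l - 1)) (n₀ * π.M ^ (l - 2)) ϑ
            (pathIncrements T (n₀ * π.M ^ (l - 1)) fun t => W l k t ω) -
              levelMean μ₀ Φ x T n₀ π.M P W₀ l| ^ p) := by
      intro ω
      rw [← ENNReal.ofReal_mul (by positivity), ← Real.mul_rpow (abs_nonneg _) (abs_nonneg _),
        ← abs_mul]
    simp only [e]
    rw [lintegral_const_mul' _ _ ENNReal.ofReal_ne_top]
    refine (mul_le_mul_right h _).trans (le_of_eq ?_)
    have h0 : 0 ≤ π.h / (π.M : ℝ) ^ (l - 2) := by positivity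
    rw [← ENNReal.ofReal_mul (by positivity)]
    congr 1
    simp only [b]
    rw [Real.mul_rpow (by positivity) (by positivity), Real.mul_rpow (by positivity)
      (by positivity), ← Real.rpow_mul hK₁0.le, ← Real.rpow_mul h0, ← sq_abs,
      ← Real.rpow_natCast |a l| 2, ← Real.rpow_mul (abs_nonneg _)]
    rw [show 2 / p * (p / 2) = 1 by field_simp, Real.rpow_one, mul_div_assoc π.β p 2,
      show ((2 : ℕ) : ℝ) * (p / 2) = p by push_cast; ring]
  let s : Finset (ℕ ×ₗ ℕ) := ((Finset.Icc 2 L).sigma fun l => Finset.Icc 1 (N l)).map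
    ⟨fun y => toLex (y.2, y.1), fun y y' h => by
      obtain ⟨h1, h2⟩ := Prod.ext_iff.1 (toLex.injective h)
      exact Sigma.ext h2 (heq_of_eq h1)⟩
  have hs : ∀ i ∈ s, 1 ≤ (ofLex i).1 ∧ 2 ≤ (ofLex i).2 := by
    intro i hi
    simp only [s, Finset.mem_map, Finset.mem_sigma, Finset.mem_Icc] at hi
    obtain ⟨y, ⟨⟨h1, _⟩, h2, _⟩, rfl⟩ := hi
    exact ⟨h2, h1⟩
  have hsum : ∀ f : ℕ → ℕ → ℝ, ∑ i ∈ s, f (ofLex i).2 (ofLex i).1 =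
      ∑ l ∈ Finset.Icc 2 L, ∑ k ∈ Finset.Icc 1 (N l), f l k := by
    intro f
    simp only [s, Finset.sum_map, Finset.sum_sigma]
    rfl
  obtain ⟨hi, hle⟩ := integral_abs_adaptive_sum_rpow_le hp hC1 hC (fun l k => (hW l k).measurable)
    hind hθ hθΘ hF hb hF0 hFb s hs
  have hae : (fun ω => |∑ i ∈ s, F (ofLex i).2 (θ (ofLex i).2 ((ofLex i).1 - 1) ω,
      fun t => W (ofLex i).2 (ofLex i).1 t ω)| ^ p) =ᵐ[μ]
      -- The two sides agree only almost surely: the likelihood ratio involves `W T` itself, which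
      -- is the sum of the increments only when `W 0 = 0`.
      fun ω => |correctionPart π ε Φ x T n₀ P (levelMean μ₀ Φ x T n₀ π.M P W₀) θ W ω| ^ p := by
    have h0 : ∀ᵐ ω ∂μ, ∀ l k, W l k 0 ω = 0 :=
      ae_all_iff.2 fun l => ae_all_iff.2 fun k => (hW l k).ae_eval_zero
    filter_upwards [h0] with ω hω
    rw [hsum fun l k => F l (θ l (k - 1) ω, fun t => W l k t ω)]
    congr 2
    unfold correctionPart
    refine Finset.sum_congr rfl fun l hl => ?_
    rw [Finset.mul_sum]
    refine Finset.sum_congr rfl fun k _ => ?_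
    rw [levelTerm_eq_weightedDiff Φ x hT hn₀ hM P _ (Finset.mem_Icc.1 hl).1 _ (hω l k)]
  refine ⟨hi.congr hae, ?_⟩
  rw [← integral_congr_ae hae]
  refine hle.trans ?_
  rw [hsum fun l _ => b l]
  have hbsum : ∑ l ∈ Finset.Icc 2 L, ∑ k ∈ Finset.Icc 1 (N l), b l ≤
      K₁ ^ (2 / p) * (π.M : ℝ) ^ π.β * (ε ^ 2 / π.V₁) := by
    refine le_trans (le_of_eq ?_) (mul_le_mul_of_nonneg_left hparam (by positivity))
    rw [Finset.mul_sum]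
    refine Finset.sum_congr rfl fun l hl => ?_
    rw [Finset.sum_const, Nat.card_Icc, Nat.add_sub_cancel, nsmul_eq_mul]
    simp only [b, a, N]
    rw [rpow_step_eq hM (Finset.mem_Icc.1 hl).1 hh0]
    -- If `N_l = 0`, the empty sum of samples matches the convention that division by zero gives 0.
    rcases eq_or_ne (π.levelSize ε L l : ℝ) 0 with h | h
    · simp [h]
    · field_simp
  calc (2 * C * ∑ l ∈ Finset.Icc 2 L, ∑ k ∈ Finset.Icc 1 (N l), b l) ^ (p / 2)
      ≤ (2 * C * (K₁ ^ (2 / p) * (π.M : ℝ) ^ π.β * (ε ^ 2 / π.V₁))) ^ (p / 2) := by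
        gcongr
    _ = (2 * C * (K₁ ^ (2 / p) * (π.M : ℝ) ^ π.β / π.V₁) * ε ^ 2) ^ (p / 2) := by
        congr 1
        ring
    _ = _ := by
        rw [Real.mul_rpow (by positivity) (by positivity), ← Real.rpow_natCast ε 2,
          ← Real.rpow_mul hε.le]
        congr 2
        push_cast
        ring

end CorrectionPart

/-! ### The uniform moment bound. -/

theorem proposition2
    (M : ℕ) (hM : 2 ≤ M) (β : ℝ) (hβ : 0 < β) (p : ℝ) (hp : 2 ≤ p) (c : ℝ) (hc : 0 < c)
    (T : ℝ≥0) (hT : 0 < T) (n₀ : ℕ) (hn₀ : 1 ≤ n₀)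
    (V₁ : ℝ) (hV₁ : 0 < V₁) (r : ℝ) (hr : p < r) (Vr : ℝ) (hVr : 0 < Vr) :
    ∃ K : ℝ, 0 < K ∧
      ∀ (d q : ℕ)
        -- the diffusion, on a filtered probability space
        (Ω₀ : Type*) [mΩ₀ : MeasurableSpace Ω₀] (μ₀ : Measure Ω₀) [IsProbabilityMeasure μ₀]
        (ℱ : Filtration ℝ≥0 mΩ₀) (W₀ : ℝ≥0 → Ω₀ → Vec q) (X : ℝ≥0 → Ω₀ → Vec d)
        (b : Vec d → Vec d) (σ : Fin q → Vec d → Vec d) (x : Vec d) (Kbσ : ℝ)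
        (_ : ∀ y z, ‖b y - b z‖ + ∑ j, ‖σ j y - σ j z‖ ≤ Kbσ * ‖y - z‖)
        (_ : IsFilteredBrownianMotion ℱ W₀ μ₀)
        (_ : IsStrongSolution ℱ μ₀ b σ x T W₀ X)
        -- the payoff and the discretization scheme
        (P : Vec d → ℝ) (_ : Measurable P)
        (_ : MemLp (fun ω => P (X T ω)) (ENNReal.ofReal p) μ₀)
        (_ : 0 < Var[fun ω => P (X T ω); μ₀])
        (Φ : ℝ → Vec d → Vec q → Vec d)
        (_ : ∀ h, Measurable fun z : Vec d × Vec q => Φ h z.1 z.2)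
        -- strong and weak error assumptions
        (_ : StrongError μ₀ Φ x T n₀ P W₀ X 2 β V₁)
        (_ : StrongError μ₀ Φ x T n₀ P W₀ X r β Vr)
        (α : ℝ) (_ : 0 < α) (coef : ℕ → ℝ)
        (_ : WeakError μ₀ Φ x T n₀ P W₀ X α coef)
        (cInf : ℝ) (_ : 0 < cInf)
        (_ : Tendsto (fun L : ℕ => |coef L| ^ (1 / (L : ℝ))) atTop (𝓝 cInf))
        -- the independent sample paths and the adaptive parameters
        (Ω : Type*) [MeasurableSpace Ω] (μ : Measure Ω) [IsProbabilityMeasure μ]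
        (W : ℕ → ℕ → ℝ≥0 → Ω → Vec q)
        (_ : ∀ l k, IsBrownianMotion (W l k) μ)
        (_ : iIndepFun (fun (i : ℕ × ℕ) (ω : Ω) (t : ℝ≥0) => W i.1 i.2 t ω) μ)
        (Θ : Set (Vec q)) (_ : IsCompact Θ) (_ : Θ ⊆ Metric.closedBall 0 c)
        (θ : ℕ → ℕ → Ω → Vec q)
        (_ : ∀ l k, 2 ≤ l → Measurable[sampleHistory W T k] (θ l k))
        (_ : ∀ l k, 2 ≤ l → ∀ ω, θ l k ω ∈ Θ)
        (ε : ℝ) (_ : 0 < ε),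
        let J : Ω → ℝ := correctionPart
          { M := M, α := α, β := β, h := (T : ℝ) / n₀, V₁ := V₁,
            var := Var[fun ω => P (X T ω); μ₀], cInf := cInf }
          ε Φ x T n₀ P (levelMean μ₀ Φ x T n₀ M P W₀) θ W
        Integrable (fun ω => |J ω| ^ p) μ ∧ ∫ ω, |J ω| ^ p ∂μ ≤ K * ε ^ p := by
  obtain ⟨C, hC1, hC⟩ := exists_abs_add_rpow_le hp
  have hM0 : (0 : ℝ) < M := by exact_mod_cast (by omega : 0 < M)
  have hK := diffMomentConst_pos (T := T) (p := p) (r := r) (c := c) hVr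
  -- Here `C` depends on `p` alone, and the witness is fixed before the depth, the weights, `α` and
  -- the parameters `θ` appear.
  refine ⟨(2 * C * ((2 ^ (p + 1) * diffMomentConst T p r c Vr) ^ (2 / p) *
    (M : ℝ) ^ β / V₁)) ^ (p / 2), by positivity, ?_⟩
  intro d q Ω₀ _ μ₀ _ ℱ W₀ X b σ x Kbσ _ hW₀ hX P hP _ hvar Φ hΦ _ hSr α hα coef _ cInf _ _
    Ω _ μ _ W hW hind Θ _ hΘ θ hθ hθΘ ε hε J
  exact integral_abs_correctionPart_rpow_le
    ⟨M, α, β, (T : ℝ) / n₀, V₁, Var[fun ω => P (X T ω); μ₀], cInf⟩ (by omega : 1 ≤ M) hα hβ hV₁ hvar hp hC1 hC hT hn₀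
    rfl hr hVr hW₀.isBrownianMotion ((hX.adapted T le_rfl).mono (ℱ.le T) le_rfl) x hP hΦ hSr hW
    hind hΘ hθ hθΘ hε
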